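/- Conventions. A $T$-PC sequence is a sequence $\zeta(n)$, $n\in\mathbb Z$, of complex random variables on a probability space with $E\zeta(n)=0$, $E|\zeta(n)|^2<\infty$, whose correlation function $R(n,m)=E\zeta(n)\overline{\zeta(m)}$ satisfies $R(n+T,m+T)=R(n,m)$, where $T\ge 1$ is the least positive integer with this property. A generating sequence of $\zeta$ is a zero-mean $T$-variate stationary sequence $\vec\xi(n)=(\xi_1(n),\dots,\xi_T(n))^\top$, defined possibly on an enlargement of the probability space, with $\zeta(n)=\sum_{\nu=1}^{T}e^{2\pi i n\nu/T}\xi_\nu(n)$. It is called a Gladyshev generating sequence if moreover $$E\,\xi_\nu(n+\tau)\overline{\xi_\mu(n)}=\frac1T\,B_{\nu-\mu}(\tau)\,e^{-2\pi i\nu\tau/T},\qquad B_k(\tau)=\frac1T\sum_{n=0}^{T-1}R(n+\tau,n)e^{-2\pi i kn/T}.$$ The spectral density $f^{\vec\xi}$ is a nonnegative definite integrable matrix function with $E\,\xi_\nu(m+n)\overline{\xi_\mu(m)}=\frac1{2\pi}\int_{-\pi}^{\pi}e^{in\lambda}f^{\vec\xi}_{\nu\mu}(\lambda)\,d\lambda$.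 The orthogonal random measure $Z^{\xi}$ of $\vec\xi$ satisfies $\xi_\nu(n)=\int_{-\pi}^{\pi}e^{in\lambda}Z^\xi_\nu(d\lambda)$ and $E Z^\xi_\nu(\Delta)\overline{Z^\xi_\mu(\Delta')}=\frac1{2\pi}\int_{\Delta\cap\Delta'}f^{\vec\xi}_{\nu\mu}(\lambda)\,d\lambda$. Let $N_1,\dots,N_s$ and $K_1,\dots,K_{s-1}$ be natural numbers, $N_0=K_0=0$, $M_l=\sum_{k=0}^{l}(N_k+K_k)$, $S=\bigcup_{l=0}^{s-1}\{M_l+1,\dots,M_l+N_{l+1}\}$, let $a(j)\in\mathbb C$, and put $A_s\zeta=\sum_{l=0}^{s-1}\sum_{j=M_l+1}^{M_l+N_{l+1}}a(j)\zeta(j)$, $\vec a(j)=(a_1(j),\dots,a_T(j))^\top$ with $a_\nu(j)=a(j)e^{2\pi i j\nu/T}$. Let $\mathbf B_s$ be the matrix of $T\times T$ blocks $$B(k,j)=\frac1{2\pi}\int_{-\pi}^{\pi}\big[(f^{\vec\xi}(\lambda))^{-1}\big]^{\top}e^{i(j-k)\lambda}\,d\lambda,\qquad k,j\in S,$$ let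 $\vec a_s=(\vec a(j))_{j\in S}$, $\vec c_s=(\vec c(j))_{j\in S}=\mathbf B_s^{-1}\vec a_s$, and put $A_s(e^{i\lambda})=\sum_{j\in S}\vec a(j)e^{ij\lambda}$, $C_s(e^{i\lambda})=\sum_{j\in S}\vec c(j)e^{ij\lambda}$ and $$\vec h^\top(f^{\vec\xi})=A_s^\top(e^{i\lambda})-C_s^\top(e^{i\lambda})\,[f^{\vec\xi}(\lambda)]^{-1}.$$ Theorem. Let $\zeta$ be a $T$-PC sequence. (i) On a suitable enlargement of the probability space, $\zeta$ has a Gladyshev generating sequence. (ii) Let $\vec\xi$ be any generating sequence of $\zeta$ that has a spectral density $f^{\vec\xi}$, invertible almost everywhere, with $\int_{-\pi}^{\pi}\mathrm{Tr}\,[(f^{\vec\xi}(\lambda))^{-1}]\,d\lambda<\infty$. Then $\mathbf B_s$ is invertible, $\vec h(f^{\vec\xi})$ belongs to $L_2^{s-}(f^{\vec\xi})$, the closed span in $L_2(f^{\vec\xi})$ of the functions $e^{ij\lambda}\delta_\nu$, $j\in\mathbb Z\setminus S$, $\nu=1,\dots,T$ (where $\delta_\nu$ are the unit vectors), the orthogonal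 random measure $Z^\xi$ exists, and $$\widehat{A_s\zeta}=\int_{-\pi}^{\pi}\vec h^\top(f^{\vec\xi})\,Z^{\xi}(d\lambda)$$ is the unique mean square optimal linear estimate of $A_s\zeta$ based on the values $\xi_\nu(j)$, $j\in\mathbb Z\setminus S$, $\nu=1,\dots,T$; its mean square error is $\Delta(f^{\vec\xi})=\langle\vec c_s,\vec a_s\rangle$. (iii) If in (ii) $\vec\xi$ is a Gladyshev generating sequence, then $\widehat{A_s\zeta}$ is the unique mean square optimal linear estimate of $A_s\zeta$ based on the observations $\zeta(j)$, $j\in\mathbb Z\setminus S$, and its mean square error is again $\langle\vec c_s,\vec a_s\rangle$. -/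

import Mathlib

open MeasureTheory Filter Topology Matrix
open scoped ComplexOrder

universe u

noncomputable section

namespace PCInterp

/-! ### Stochastic sequences

Random variables with finite second moment are elements of `L²(P) = Lp ℂ 2 P`, so equality of
random variables is almost sure equality. -/

section Sequences

variable {Ω : Type u} [MeasurableSpace Ω]

/-- The correlation `E X conj(Y)`. -/
def corr (P : Measure Ω) (X Y : Lp ℂ 2 P) : ℂ :=
  ∫ w, X w * (starRingEnd ℂ) (Y w) ∂P

/-- The mean square error `E |X - Y|²`. -/
def mse (P : Measure Ω) (X Y : Lp ℂ 2 P) : ℝ :=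
  ∫ w, ‖X w - Y w‖ ^ 2 ∂P

/-- `ζ` is periodically correlated with period `T` (`T`-PC): zero mean, finite variance,
`T`-periodic correlation function, and no smaller positive period. -/
structure IsPC (P : Measure Ω) (T : ℕ) (ζ : ℤ → Lp ℂ 2 P) : Prop where
  pos : 0 < T
  mean : ∀ n, ∫ w, ζ n w ∂P = 0
  periodic : ∀ n m : ℤ, corr P (ζ (n + T)) (ζ (m + T)) = corr P (ζ n) (ζ m)
  least : ∀ T' : ℕ, 0 < T' → T' < T →
    ¬ ∀ n m : ℤ, corr P (ζ (n + T')) (ζ (m + T')) = corr P (ζ n) (ζ m)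

/-- `ξ` is a `T`-variate stationary sequence with zero mean. -/
structure IsStationary (P : Measure Ω) {T : ℕ} (ξ : ℤ → Fin T → Lp ℂ 2 P) : Prop where
  mean : ∀ n ν, ∫ w, ξ n ν w ∂P = 0
  stationary : ∀ (n m k : ℤ) (ν μ : Fin T),
    corr P (ξ (n + k) ν) (ξ (m + k) μ) = corr P (ξ n ν) (ξ m μ)

/-- `e^{2π i x / T}`. -/
def rootExp (T : ℕ) (x : ℤ) : ℂ :=
  Complex.exp (2 * Real.pi * Complex.I * x / T)

/-- The component `ν : Fin T` carries the label `ν + 1 ∈ {1, …, T}`. -/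
def label {T : ℕ} (ν : Fin T) : ℤ := (ν : ℤ) + 1

/-- `ξ` is a generating sequence of `ζ`: it is `T`-variate stationary and
`ζ(n) = ∑_{ν=1}^T e^{2π i n ν / T} ξ_ν(n)`. -/
structure IsGenerating (P : Measure Ω) (T : ℕ) (ζ : ℤ → Lp ℂ 2 P)
    (ξ : ℤ → Fin T → Lp ℂ 2 P) : Prop where
  stationary : IsStationary P ξ
  repr : ∀ n, ζ n = ∑ ν, rootExp T (n * label ν) • ξ n ν

/-- The Fourier coefficients `B_k(τ) = T⁻¹ ∑_{n=0}^{T-1} R(n+τ, n) e^{-2π i k n / T}` of the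
correlation function `R(n,m) = E ζ(n) conj(ζ(m))`. -/
def gladyshevCoeff (P : Measure Ω) (T : ℕ) (ζ : ℤ → Lp ℂ 2 P) (k τ : ℤ) : ℂ :=
  (T : ℂ)⁻¹ * ∑ n ∈ Finset.range T, corr P (ζ (n + τ)) (ζ n) * rootExp T (-(k * n))

/-- `ξ` is a generating sequence of `ζ` whose covariance matrix is Gladyshev's one,
`R_{νμ}(τ) = T⁻¹ B_{ν-μ}(τ) e^{-2π i ν τ / T}`. -/
structure IsGladyshevGenerating (P : Measure Ω) (T : ℕ) (ζ : ℤ → Lp ℂ 2 P)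
    (ξ : ℤ → Fin T → Lp ℂ 2 P) : Prop where
  generating : IsGenerating P T ζ ξ
  cov : ∀ (n τ : ℤ) (ν μ : Fin T), corr P (ξ (n + τ) ν) (ξ n μ) =
    (T : ℂ)⁻¹ * gladyshevCoeff P T ζ (label ν - label μ) τ * rootExp T (-(label ν * τ))

/-- `Y` is an optimal linear estimate of `X` from the observations `obs i`, `i ∈ I`: it lies in
the closed linear span of the observations in `L²(P)` and has the least mean square error there. -/
def IsOptimalEstimate (P : Measure Ω) {ι : Type*} (obs : ι → Lp ℂ 2 P) (I : Set ι)
    (X Y : Lp ℂ 2 P) : Prop :=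
  Y ∈ (Submodule.span ℂ (obs '' I)).topologicalClosure ∧
    ∀ Y' ∈ (Submodule.span ℂ (obs '' I)).topologicalClosure, mse P X Y ≤ mse P X Y'

end Sequences

/-! ### Spectral densities and the space `L₂(f)` -/

/-- Lebesgue measure on `(-π, π]`. -/
def circleVol : Measure ℝ := volume.restrict (Set.Ioc (-Real.pi) Real.pi)

/-- `e^{i j x}`. -/
def cexpI (j : ℤ) (x : ℝ) : ℂ := Complex.exp (Complex.I * j * x)

/-- `f` is the spectral density matrix of the stationary sequence `ξ`:
`E ξ_ν(m+n) conj(ξ_μ(m)) = (2π)⁻¹ ∫_{-π}^{π} e^{i n x} f_{νμ}(x) dx`. -/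
structure IsSpectralDensity {Ω : Type u} [MeasurableSpace Ω] (P : Measure Ω) {T : ℕ}
    (ξ : ℤ → Fin T → Lp ℂ 2 P) (f : ℝ → Matrix (Fin T) (Fin T) ℂ) : Prop where
  integrable : ∀ ν μ, Integrable (fun x => f x ν μ) circleVol
  posSemidef : ∀ᵐ x ∂circleVol, (f x).PosSemidef
  cov : ∀ (m n : ℤ) (ν μ : Fin T), corr P (ξ (m + n) ν) (ξ m μ) =
    (2 * Real.pi : ℂ)⁻¹ * ∫ x, cexpI n x * f x ν μ ∂circleVol

/-- The minimality condition `∫_{-π}^{π} Tr f(x)⁻¹ dx < ∞`. -/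
def MinimalityCondition {T : ℕ} (f : ℝ → Matrix (Fin T) (Fin T) ℂ) : Prop :=
  (∀ᵐ x ∂circleVol, IsUnit (f x).det) ∧ Integrable (fun x => ((f x)⁻¹).trace) circleVol

/-- The quadratic form `b(x)ᵀ f(x) conj(b(x))` (real when `f(x)` is nonnegative definite). -/
def qform {T : ℕ} (f : ℝ → Matrix (Fin T) (Fin T) ℂ) (b : ℝ → Fin T → ℂ) (x : ℝ) : ℝ :=
  (b x ⬝ᵥ (f x *ᵥ star (b x))).re

/-- `b ∈ L₂(f)`. -/
def MemL2 {T : ℕ} (f : ℝ → Matrix (Fin T) (Fin T) ℂ) (b : ℝ → Fin T → ℂ) : Prop :=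
  AEStronglyMeasurable b circleVol ∧ Integrable (qform f b) circleVol

/-- The squared norm of `b` in `L₂(f)`. -/
def sqNorm {T : ℕ} (f : ℝ → Matrix (Fin T) (Fin T) ℂ) (b : ℝ → Fin T → ℂ) : ℝ :=
  ∫ x, qform f b x ∂circleVol

/-- The vector trigonometric polynomial `∑_j p(j) e^{i j x}`. -/
def trigPoly {T : ℕ} (p : ℤ →₀ (Fin T → ℂ)) (x : ℝ) : Fin T → ℂ :=
  p.sum fun j v => cexpI j x • v

/-- `b ∈ L₂^{s-}(f)`: the closed span in `L₂(f)` of the functions `e^{ijx} δ_ν`, `j ∉ S`. -/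
def MemL2Minus {T : ℕ} (S : Finset ℤ) (f : ℝ → Matrix (Fin T) (Fin T) ℂ)
    (b : ℝ → Fin T → ℂ) : Prop :=
  MemL2 f b ∧ ∀ ε > 0, ∃ p : ℤ →₀ (Fin T → ℂ), Disjoint p.support S ∧
    sqNorm f (fun x => b x - trigPoly p x) < ε

/-! ### Random measures and stochastic integrals -/

section RandomMeasure

variable {Ω : Type u} [MeasurableSpace Ω]

/-- `∫ φᵀ(x) Z(dx)` for a simple function `φ`. -/
def simpleIntegral (P : Measure Ω) {T : ℕ} (Z : Fin T → Set ℝ → Lp ℂ 2 P)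
    (φ : SimpleFunc ℝ (Fin T → ℂ)) : Lp ℂ 2 P :=
  ∑ v ∈ φ.range, ∑ ν, v ν • Z ν (φ ⁻¹' {v})

/-- `Y = ∫_{-π}^{π} hᵀ(x) Z(dx)`: `h ∈ L₂(f)`, and `Y` is the `L²(P)`-limit of the integrals of
simple functions converging to `h` in `L₂(f)`, where `f` is the density of the covariance of `Z`. -/
def IsStochIntegral (P : Measure Ω) {T : ℕ} (f : ℝ → Matrix (Fin T) (Fin T) ℂ)
    (Z : Fin T → Set ℝ → Lp ℂ 2 P) (h : ℝ → Fin T → ℂ) (Y : Lp ℂ 2 P) : Prop :=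
  MemL2 f h ∧ ∃ φ : ℕ → SimpleFunc ℝ (Fin T → ℂ),
    Tendsto (fun n => sqNorm f (fun x => h x - φ n x)) atTop (𝓝 0) ∧
    Tendsto (fun n => simpleIntegral P Z (φ n)) atTop (𝓝 Y)

/-- `Z` is the orthogonal random measure `Z^ξ` on `(-π, π]` of the stationary sequence `ξ` with
spectral density `f`: `E Z_ν(Δ) conj(Z_μ(Δ')) = (2π)⁻¹ ∫_{Δ ∩ Δ'} f_{νμ}(x) dx` and
`ξ_ν(n) = ∫ e^{inx} Z_ν(dx)`. -/
structure IsOrthogonalRandomMeasure (P : Measure Ω) {T : ℕ} (ξ : ℤ → Fin T → Lp ℂ 2 P)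
    (f : ℝ → Matrix (Fin T) (Fin T) ℂ) (Z : Fin T → Set ℝ → Lp ℂ 2 P) : Prop where
  cov : ∀ (ν μ : Fin T) (Δ Δ' : Set ℝ), MeasurableSet Δ → MeasurableSet Δ' →
    corr P (Z ν Δ) (Z μ Δ') = (2 * Real.pi : ℂ)⁻¹ * ∫ x in Δ ∩ Δ', f x ν μ ∂circleVol
  repr : ∀ (n : ℤ) (ν : Fin T),
    IsStochIntegral P f Z (fun x => Pi.single ν (cexpI n x)) (ξ n ν)

end RandomMeasure

/-! ### The interpolation problem -/

/-- `M_l = ∑_{k=0}^l (N_k + K_k)`. -/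
def blockStart (N K : ℕ → ℕ) (l : ℕ) : ℕ := ∑ k ∈ Finset.range (l + 1), (N k + K k)

/-- The `l`-th block `{M_l + 1, …, M_l + N_{l+1}}` of missed observations. -/
def block (N K : ℕ → ℕ) (l : ℕ) : Finset ℤ :=
  Finset.Icc ((blockStart N K l : ℤ) + 1) ((blockStart N K l : ℤ) + N (l + 1))

/-- The set `S = ⋃_{l=0}^{s-1} {M_l + 1, …, M_l + N_{l+1}}`. -/
def missing (N K : ℕ → ℕ) (s : ℕ) : Finset ℤ := (Finset.range s).biUnion (block N K)

/-- `∑_{l=0}^{s-1} ∑_{j=M_l+1}^{M_l+N_{l+1}} g(j)`. -/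
def blockSum {E : Type*} [AddCommMonoid E] (N K : ℕ → ℕ) (s : ℕ) (g : ℤ → E) : E :=
  ∑ l ∈ Finset.range s, ∑ j ∈ block N K l, g j

/-- The functional `A_s ζ`. -/
def functional {Ω : Type u} [MeasurableSpace Ω] {P : Measure Ω} (N K : ℕ → ℕ) (s : ℕ)
    (a : ℤ → ℂ) (ζ : ℤ → Lp ℂ 2 P) : Lp ℂ 2 P :=
  blockSum N K s fun j => a j • ζ j

/-- The vector coefficients `a_ν(j) = a(j) e^{2π i j ν / T}`. -/
def vecCoeff (T : ℕ) (a : ℤ → ℂ) (j : ℤ) : Fin T → ℂ :=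
  fun ν => a j * rootExp T (j * label ν)

/-- The matrix `B_s`. Its rows and columns are indexed by the pairs (point of `S`, component), and
its `T × T` block at `(k, j)` is `(2π)⁻¹ ∫_{-π}^{π} [f(x)⁻¹]ᵀ e^{i(j-k)x} dx`. -/
def matB {T : ℕ} (S : Finset ℤ) (f : ℝ → Matrix (Fin T) (Fin T) ℂ) :
    Matrix (S × Fin T) (S × Fin T) ℂ :=
  fun k j => (2 * Real.pi : ℂ)⁻¹ *
    ∫ x, ((f x)⁻¹)ᵀ k.2 j.2 * cexpI ((j.1 : ℤ) - (k.1 : ℤ)) x ∂circleVol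

/-- The column vector `a_s` built of the vectors `a(j)`, `j ∈ S`. -/
def stackA (T : ℕ) (S : Finset ℤ) (a : ℤ → ℂ) : S × Fin T → ℂ :=
  fun k => vecCoeff T a k.1 k.2

/-- The column vector `c_s = B_s⁻¹ a_s`. -/
def stackC {T : ℕ} (S : Finset ℤ) (f : ℝ → Matrix (Fin T) (Fin T) ℂ) (a : ℤ → ℂ) :
    S × Fin T → ℂ :=
  (matB S f)⁻¹ *ᵥ stackA T S a

/-- The vectors `c(j)`, `j ∈ S`, of which `c_s` is built. -/
def coeffC {T : ℕ} (S : Finset ℤ) (f : ℝ → Matrix (Fin T) (Fin T) ℂ) (a : ℤ → ℂ) (j : ℤ) :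
    Fin T → ℂ :=
  fun ν => if hj : j ∈ S then stackC S f a (⟨j, hj⟩, ν) else 0

/-- The spectral characteristic `hᵀ = A_sᵀ(e^{ix}) - C_sᵀ(e^{ix}) f(x)⁻¹`, where
`A_s(e^{ix}) = ∑ a(j) e^{ijx}` and `C_s(e^{ix}) = ∑ c(j) e^{ijx}` are sums over the blocks. -/
def specChar {T : ℕ} (N K : ℕ → ℕ) (s : ℕ) (f : ℝ → Matrix (Fin T) (Fin T) ℂ) (a : ℤ → ℂ)
    (x : ℝ) : Fin T → ℂ :=
  blockSum N K s (fun j => cexpI j x • vecCoeff T a j) -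
    blockSum N K s (fun j => cexpI j x • coeffC (missing N K s) f a j) ᵥ* (f x)⁻¹

/-- The value `⟨c_s, a_s⟩` of the mean square error. -/
def errValue {T : ℕ} (S : Finset ℤ) (f : ℝ → Matrix (Fin T) (Fin T) ℂ) (a : ℤ → ℂ) : ℂ :=
  ∑ k, stackC S f a k * (starRingEnd ℂ) (stackA T S a k)

end PCInterp

end

noncomputable section

namespace PCInterp

/-! The problem is moved from $L^2(P)$ to the weighted space $L_2(f)$ and solved there with a
biorthogonal system.

By the definition of a spectral density, $e^{ijx}\delta_\nu \mapsto \xi_\nu(j)$ preserves inner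
products. Trigonometric polynomials are dense in $L_2(f)$ (`denseRange_trig`), so this map extends
to an isometry $V$ into $L^2(P)$. Every orthogonal random measure of $\xi$ equals
$V(1_\Delta\delta_\nu)$ (`eq_isometry`), so stochastic integration is $V$ itself
(`isStochIntegral_iff`). It remains to project $A_s$ on the closed span of the exponentials with
frequencies outside $S$.

Under minimality $f^{-1}$ is also a density, and $C \mapsto C^\top f^{-1}$ maps $L_2(f^{-1})$
isometrically into $L_2(f)$. The weight cancels in the pairing, so the images of the exponentials
are biorthogonal to the exponentials (`inner_dual_trig`). Three consequences carry the theorem. The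
matrix $B_s$ is the Gram matrix of the dual vectors with index in $S$; biorthogonality makes them
independent, so $B_s$ is invertible. The error $A_s - h = C_s^\top f^{-1}$ is a combination of these
vectors, hence orthogonal to all exponentials off $S$. The equation $B_s c_s = a_s$ makes $h$
orthogonal to them, and therefore $h$ is a limit of polynomials without frequencies in $S$
(`exists_tendsto_charL2`): in any approximating sequence the coefficients on $S$ tend to zero and
can be dropped. The squared error is $c_s^* B_s c_s$.

For existence, take independent copies $\zeta_k$ of $\zeta$, $0 \le k < T$, and put $\xi_\nu(n) =
T^{-1}\sum_k e^{-2\pi i(n+k)\nu/T}\zeta_k(n+k)$. Independence removes the cross terms of the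
covariance, and summation over $\nu$ returns $\zeta_0(n)$.

For a Gladyshev sequence, $\xi_\nu(n)$ is a combination of $\zeta(n)$ and of twisted sums orthogonal
to every $\zeta(m)$ (`corr_twist_eq_zero`). The error of projecting on $\zeta(j)$, $j\notin S$, is
thus orthogonal to all $\xi_\nu(j)$, $j \notin S$, as well, and the two estimates coincide. -/

instance : IsFiniteMeasure circleVol := by
  unfold circleVol; infer_instance

/-! ### The pre-Hilbert space `L₂(f)` -/

/-- A spectral density matrix on `(-π, π]`: integrable and nonnegative definite. -/
structure Density (T : ℕ) where
  toFun : ℝ → Matrix (Fin T) (Fin T) ℂ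
  integrable : ∀ ν μ, Integrable (fun x => toFun x ν μ) circleVol
  posSemidef : ∀ᵐ x ∂circleVol, (toFun x).PosSemidef

section SpectralSpace

variable {T : ℕ}

/-- The sesquilinear form `c(x)ᵀ f(x) conj(b(x))`. -/
def sform (f : ℝ → Matrix (Fin T) (Fin T) ℂ) (b c : ℝ → Fin T → ℂ) (x : ℝ) : ℂ :=
  c x ⬝ᵥ (f x *ᵥ star (b x))

theorem sform_eq_sum (f : ℝ → Matrix (Fin T) (Fin T) ℂ) (b c : ℝ → Fin T → ℂ) (x : ℝ) :
    sform f b c x = ∑ ν, ∑ μ, c x ν * f x ν μ * (starRingEnd ℂ) (b x μ) := by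
  simp [sform, dotProduct, mulVec, Finset.mul_sum, mul_assoc]

theorem sform_add_left (f : ℝ → Matrix (Fin T) (Fin T) ℂ) (b b' c : ℝ → Fin T → ℂ) (x : ℝ) :
    sform f (b + b') c x = sform f b c x + sform f b' c x := by
  simp [sform, mulVec_add, dotProduct_add]

theorem sform_smul_left (f : ℝ → Matrix (Fin T) (Fin T) ℂ) (b c : ℝ → Fin T → ℂ) (r : ℂ)
    (x : ℝ) : sform f (r • b) c x = (starRingEnd ℂ) r * sform f b c x := by
  simp [sform, mulVec_smul, dotProduct_smul]

theorem sform_conj {f : ℝ → Matrix (Fin T) (Fin T) ℂ} {x : ℝ} (hx : (f x).PosSemidef)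
    (b c : ℝ → Fin T → ℂ) : (starRingEnd ℂ) (sform f b c x) = sform f c b x := by
  have h := fun i j => hx.1.apply i j
  simp only [RCLike.star_def] at h
  rw [sform_eq_sum, sform_eq_sum, Finset.sum_comm]
  simp only [map_sum, map_mul, h, RingHomCompTriple.comp_apply, RingHom.id_apply]
  exact Finset.sum_congr rfl fun _ _ => Finset.sum_congr rfl fun _ _ => by ring

theorem sform_self_nonneg {f : ℝ → Matrix (Fin T) (Fin T) ℂ} {x : ℝ} (hx : (f x).PosSemidef)
    (b : ℝ → Fin T → ℂ) : 0 ≤ sform f b b x := by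
  have h := hx.dotProduct_mulVec_nonneg (star (b x))
  rwa [star_star] at h

theorem qform_nonneg {f : ℝ → Matrix (Fin T) (Fin T) ℂ} {x : ℝ} (hx : (f x).PosSemidef)
    (b : ℝ → Fin T → ℂ) : 0 ≤ qform f b x :=
  (Complex.nonneg_iff.1 (sform_self_nonneg hx b)).1

theorem sform_self {f : ℝ → Matrix (Fin T) (Fin T) ℂ} {x : ℝ} (hx : (f x).PosSemidef)
    (b : ℝ → Fin T → ℂ) : sform f b b x = (qform f b x : ℂ) := by
  refine Complex.ext (by simp [qform, sform]) ?_
  simpa using (Complex.nonneg_iff.1 (sform_self_nonneg hx b)).2.symm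

-- Factoring $f(x) = B^*B$ turns the form into a coordinatewise sum of products, bounded by $2|uv|
-- \le |u|^2+|v|^2$. It makes cross terms integrable once the two quadratic forms are.
open scoped MatrixOrder in
theorem norm_sform_le {f : ℝ → Matrix (Fin T) (Fin T) ℂ} {x : ℝ} (hx : (f x).PosSemidef)
    (b c : ℝ → Fin T → ℂ) : ‖sform f b c x‖ ≤ qform f b x + qform f c x := by
  obtain ⟨B, hB⟩ := CStarAlgebra.nonneg_iff_eq_star_mul_self.1 hx.nonneg
  have key : ∀ b c : ℝ → Fin T → ℂ, sform f b c x =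
      ∑ i, (starRingEnd ℂ) ((B *ᵥ star (c x)) i) * (B *ᵥ star (b x)) i := by
    intro b c
    have h : sform f b c x = star (B *ᵥ star (c x)) ⬝ᵥ (B *ᵥ star (b x)) := by
      rw [star_mulVec, star_star, ← dotProduct_mulVec, mulVec_mulVec, sform, hB,
        star_eq_conjTranspose]
    simp [h, dotProduct]
  have hq : ∀ b : ℝ → Fin T → ℂ, qform f b x = ∑ i, ‖(B *ᵥ star (b x)) i‖ ^ 2 := by
    intro b
    have := key b b
    rw [sform_self hx] at this
    simp_rw [Complex.conj_mul'] at this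
    exact_mod_cast this
  rw [key, hq, hq, ← Finset.sum_add_distrib]
  refine (norm_sum_le _ _).trans (Finset.sum_le_sum fun i _ => ?_)
  rw [norm_mul, RCLike.norm_conj]
  nlinarith [sq_nonneg (‖(B *ᵥ star (b x)) i‖ - ‖(B *ᵥ star (c x)) i‖),
    sq_nonneg ‖(B *ᵥ star (b x)) i‖, sq_nonneg ‖(B *ᵥ star (c x)) i‖]

theorem aestronglyMeasurable_sform {f : ℝ → Matrix (Fin T) (Fin T) ℂ}
    (hf : ∀ ν μ, AEStronglyMeasurable (fun x => f x ν μ) circleVol) {b c : ℝ → Fin T → ℂ}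
    (hb : AEStronglyMeasurable b circleVol) (hc : AEStronglyMeasurable c circleVol) :
    AEStronglyMeasurable (sform f b c) circleVol := by
  have h : ∀ {b : ℝ → Fin T → ℂ}, AEStronglyMeasurable b circleVol →
      ∀ ν, AEStronglyMeasurable (fun x => b x ν) circleVol :=
    fun hb ν => (continuous_apply ν).comp_aestronglyMeasurable hb
  have : sform f b c = fun x => ∑ ν, ∑ μ, c x ν * f x ν μ * (starRingEnd ℂ) (b x μ) :=
    funext (sform_eq_sum f b c)
  rw [this]
  refine Finset.aestronglyMeasurable_fun_sum _ fun ν _ =>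
    Finset.aestronglyMeasurable_fun_sum _ fun μ _ => ?_
  exact ((h hc ν).mul (hf ν μ)).mul
    (Complex.continuous_conj.comp_aestronglyMeasurable (h hb μ))

theorem aestronglyMeasurable_qform {f : ℝ → Matrix (Fin T) (Fin T) ℂ}
    (hf : ∀ ν μ, AEStronglyMeasurable (fun x => f x ν μ) circleVol) {b : ℝ → Fin T → ℂ}
    (hb : AEStronglyMeasurable b circleVol) :
    AEStronglyMeasurable (qform f b) circleVol :=
  Complex.continuous_re.comp_aestronglyMeasurable (aestronglyMeasurable_sform hf hb hb)

namespace Density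

variable (F : Density T)

theorem aestronglyMeasurable (ν μ : Fin T) :
    AEStronglyMeasurable (fun x => F.toFun x ν μ) circleVol := (F.integrable ν μ).1

theorem integrable_sform {b c : ℝ → Fin T → ℂ} (hb : MemL2 F.toFun b) (hc : MemL2 F.toFun c) :
    Integrable (sform F.toFun b c) circleVol := by
  refine (hb.2.add hc.2).mono' (aestronglyMeasurable_sform F.aestronglyMeasurable hb.1 hc.1) ?_
  filter_upwards [F.posSemidef] with x hx using norm_sform_le hx b c

theorem memL2_add {b c : ℝ → Fin T → ℂ} (hb : MemL2 F.toFun b) (hc : MemL2 F.toFun c) :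
    MemL2 F.toFun (b + c) := by
  refine ⟨hb.1.add hc.1, ?_⟩
  have h := ((hb.2.add hc.2).add ((F.integrable_sform hb hc).re.const_mul 2))
  refine h.congr ?_
  filter_upwards [F.posSemidef] with x hx
  have h2 := congrArg Complex.re (sform_conj hx b c)
  simp only [Complex.conj_re] at h2
  have h3 : sform F.toFun (b + c) (b + c) x = sform F.toFun b b x + sform F.toFun c c x +
      (sform F.toFun b c x + sform F.toFun c b x) := by
    simp [sform, mulVec_add, dotProduct_add]; ring
  have h4 : qform F.toFun (b + c) x = (sform F.toFun (b + c) (b + c) x).re := rfl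
  rw [h4, h3]
  simp only [Pi.add_apply, Complex.add_re, ← h2, RCLike.re_eq_complex_re]
  simp only [qform, sform]; ring

theorem memL2_smul (r : ℂ) {b : ℝ → Fin T → ℂ} (hb : MemL2 F.toFun b) :
    MemL2 F.toFun (r • b) := by
  refine ⟨hb.1.const_smul r, ?_⟩
  refine (hb.2.const_mul (‖r‖ ^ 2)).congr (Eventually.of_forall fun x => ?_)
  have : sform F.toFun (r • b) (r • b) x = ((‖r‖ ^ 2 : ℝ) : ℂ) * sform F.toFun b b x := by
    rw [sform_smul_left]
    push_cast
    rw [← Complex.conj_mul']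
    simp [sform, mul_assoc]
  have h4 : qform F.toFun (r • b) x = (sform F.toFun (r • b) (r • b) x).re := rfl
  rw [h4, this, Complex.re_ofReal_mul]; rfl

theorem memL2_zero : MemL2 F.toFun 0 :=
  by
  refine ⟨aestronglyMeasurable_const, ?_⟩
  have : qform F.toFun 0 = 0 := by ext; simp [qform]
  rw [this]; exact integrable_zero _ _ _

/-- `L₂(f)` as a space of functions. -/
def submodule : Submodule ℂ (ℝ → Fin T → ℂ) where
  carrier := {b | MemL2 F.toFun b}
  add_mem' := F.memL2_add
  zero_mem' := F.memL2_zero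
  smul_mem' r _ := F.memL2_smul r

/-- `L₂(f)` with its semi-inner product `(2π)⁻¹ ∫ c(x)ᵀ f(x) conj(b(x)) dx`. -/
def L2 : Type := F.submodule

instance : AddCommGroup F.L2 := inferInstanceAs (AddCommGroup F.submodule)
instance : Module ℂ F.L2 := inferInstanceAs (Module ℂ F.submodule)

variable {F}

/-- The function representing an element of `L₂(f)`. -/
def fn (b : F.L2) : ℝ → Fin T → ℂ := Subtype.val (p := (· ∈ F.submodule)) b

theorem memL2_fn (b : F.L2) : MemL2 F.toFun (fn b) := Subtype.property (p := (· ∈ F.submodule)) b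

variable (F) in
/-- A function of finite norm as an element of `L₂(f)`. -/
def elem (b : ℝ → Fin T → ℂ) (hb : MemL2 F.toFun b) : F.L2 := (⟨b, hb⟩ : F.submodule)

@[simp] theorem fn_elem (b : ℝ → Fin T → ℂ) (hb : MemL2 F.toFun b) : fn (F.elem b hb) = b := rfl
@[simp] theorem fn_add (b c : F.L2) : fn (b + c) = fn b + fn c := rfl
@[simp] theorem fn_sub (b c : F.L2) : fn (b - c) = fn b - fn c := rfl
@[simp] theorem fn_smul (r : ℂ) (b : F.L2) : fn (r • b) = r • fn b := rfl

theorem fn_injective : Function.Injective (fn : F.L2 → ℝ → Fin T → ℂ) := Subtype.val_injective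

variable (F) in
/-- `fn` as a linear map. -/
def fnₗ : F.L2 →ₗ[ℂ] (ℝ → Fin T → ℂ) where
  toFun := fn
  map_add' _ _ := rfl
  map_smul' _ _ := rfl

@[simp] theorem fnₗ_apply (b : F.L2) : F.fnₗ b = fn b := rfl

/-- Only a semi-inner product: elements stay honest functions, with no quotient, so that explicit
formulas are literally elements. The factor $(2\pi)^{-1}$ matches the covariance normalization. -/
instance : PreInnerProductSpace.Core ℂ F.L2 where
  inner b c := (2 * Real.pi : ℂ)⁻¹ * ∫ x, sform F.toFun (fn b) (fn c) x ∂circleVol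
  conj_inner_symm b c := by
    rw [map_mul, ← integral_conj]
    congr 1
    · simp [Complex.conj_ofNat]
    · refine integral_congr_ae ?_
      filter_upwards [F.posSemidef] with x hx using sform_conj hx _ _
  re_inner_nonneg b := by
    have h : ∫ x, sform F.toFun (fn b) (fn b) x ∂circleVol =
        ((∫ x, qform F.toFun (fn b) x ∂circleVol : ℝ) : ℂ) := by
      rw [← integral_complex_ofReal]
      refine integral_congr_ae ?_
      filter_upwards [F.posSemidef] with x hx using sform_self hx _
    rw [h]
    have h0 : 0 ≤ ∫ x, qform F.toFun (fn b) x ∂circleVol := by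
      refine integral_nonneg_of_ae ?_
      filter_upwards [F.posSemidef] with x hx using qform_nonneg hx _
    have h1 : (2 * Real.pi : ℂ)⁻¹ = ((2 * Real.pi)⁻¹ : ℝ) := by push_cast; rfl
    rw [h1, ← Complex.ofReal_mul]
    simp only [RCLike.re_eq_complex_re, Complex.ofReal_re]
    have := Real.pi_pos
    positivity
  add_left b b' c := by
    rw [← mul_add, ← integral_add (F.integrable_sform (memL2_fn b) (memL2_fn c))
      (F.integrable_sform (memL2_fn b') (memL2_fn c))]
    simp only [fn_add, sform_add_left]
  smul_left b c r := by
    simp only [fn_smul, sform_smul_left, integral_const_mul]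
    ring

instance : SeminormedAddCommGroup F.L2 := InnerProductSpace.Core.toSeminormedAddCommGroup (𝕜 := ℂ)
instance : InnerProductSpace ℂ F.L2 := InnerProductSpace.ofCore inferInstance

theorem inner_eq (b c : F.L2) :
    inner ℂ b c = (2 * Real.pi : ℂ)⁻¹ * ∫ x, sform F.toFun (fn b) (fn c) x ∂circleVol := rfl

theorem sqNorm_eq (b : F.L2) : sqNorm F.toFun (fn b) = 2 * Real.pi * ‖b‖ ^ 2 := by
  have h : ∫ x, sform F.toFun (fn b) (fn b) x ∂circleVol = (sqNorm F.toFun (fn b) : ℂ) := by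
    rw [sqNorm, ← integral_complex_ofReal]
    refine integral_congr_ae ?_
    filter_upwards [F.posSemidef] with x hx using sform_self hx _
  have h2 : ((‖b‖ ^ 2 : ℝ) : ℂ) = (2 * Real.pi : ℂ)⁻¹ * (sqNorm F.toFun (fn b) : ℂ) := by
    rw [← h, ← inner_eq, inner_self_eq_norm_sq_to_K]; simp
  have hpi : (2 * Real.pi : ℂ) ≠ 0 := by simp [Real.pi_ne_zero]
  rw [eq_inv_mul_iff_mul_eq₀ hpi] at h2
  exact_mod_cast h2.symm

end Density

end SpectralSpace

/-! ### Density of simple functions and of trigonometric polynomials in `L₂(f)` -/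

@[simp] theorem norm_cexpI (j : ℤ) (x : ℝ) : ‖cexpI j x‖ = 1 := by
  rw [cexpI, show Complex.I * j * x = ((j * x : ℝ) : ℂ) * Complex.I by push_cast; ring,
    Complex.norm_exp_ofReal_mul_I]

theorem continuous_cexpI (j : ℤ) : Continuous (cexpI j) := by
  unfold cexpI; fun_prop

open scoped ENNReal in
/-- Trigonometric polynomials approximate bounded measurable functions in mean square with respect
to a finite measure on `(-π, π]`. -/
theorem exists_trigPoly_eLpNorm_sub_lt (m : Measure ℝ) [IsFiniteMeasure m]
    (hm : ∀ᵐ x ∂m, x ∈ Set.Ioc (-Real.pi) Real.pi) {g : ℝ → ℂ} (hg : Measurable g) {C : ℝ}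
    (hC : ∀ x, ‖g x‖ ≤ C) {ε : ℝ≥0∞} (hε : ε ≠ 0) :
    ∃ p : ℤ →₀ ℂ, eLpNorm (fun x => g x - p.sum fun j c => c * cexpI j x) 2 m < ε := by
  have : Fact (0 < 2 * Real.pi) := ⟨Real.two_pi_pos⟩
  have hper : -Real.pi + 2 * Real.pi = Real.pi := by ring
  -- Transport to the circle, where Fourier monomials span a dense subspace of the continuous
  -- functions, hence of $L^2$ of the pushed forward measure. The section `r` of `q` on $(-\pi,\pi]$
  -- carries `g` over.
  set q : ℝ → AddCircle (2 * Real.pi) := fun x => (x : AddCircle (2 * Real.pi)) with hq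
  have hqm : Measurable q := (AddCircle.continuous_mk' _).measurable
  set r : AddCircle (2 * Real.pi) → ℝ :=
    fun y => (AddCircle.measurableEquivIoc (2 * Real.pi) (-Real.pi) y : ℝ) with hr
  have hrm : Measurable r :=
    measurable_subtype_coe.comp (AddCircle.measurableEquivIoc (2 * Real.pi) (-Real.pi)).measurable
  have hrq : ∀ x ∈ Set.Ioc (-Real.pi) Real.pi, r (q x) = x := fun x hx =>
    AddCircle.equivIoc_coe_of_mem (p := 2 * Real.pi) (a := -Real.pi) (by rwa [hper])
  set ν := m.map q with hν
  have hgr : MemLp (g ∘ r) 2 ν :=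
    MemLp.of_bound (hg.comp hrm).aestronglyMeasurable C (Eventually.of_forall fun y => hC _)
  have hdense := (ContinuousMap.toLp_denseRange ℂ ν ℂ
    (p := 2) (by norm_num)).topologicalClosure_map_submodule
      (span_fourier_closure_eq_top (T := 2 * Real.pi))
  have hmem : hgr.toLp ∈ closure ((Submodule.map (ContinuousMap.toLp 2 ν ℂ :
      C(AddCircle (2 * Real.pi), ℂ) →L[ℂ] Lp ℂ 2 ν).toLinearMap
        (Submodule.span ℂ (Set.range (fourier (T := 2 * Real.pi)))) : Submodule ℂ _) :
          Set (Lp ℂ 2 ν)) := by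
    rw [← Submodule.topologicalClosure_coe, hdense]; trivial
  obtain ⟨_, ⟨P, hP, rfl⟩, hlt⟩ := EMetric.mem_closure_iff.1 hmem ε (pos_iff_ne_zero.2 hε)
  obtain ⟨c, rfl⟩ := Finsupp.mem_span_range_iff_exists_finsupp.1 hP
  refine ⟨c, lt_of_eq_of_lt ?_ hlt⟩
  set P : C(AddCircle (2 * Real.pi), ℂ) := c.sum fun i a => a • fourier i with hPdef
  have hPL : MemLp P 2 ν := MemLp.of_bound P.continuous.aestronglyMeasurable ‖P‖
    (Eventually.of_forall fun y => P.norm_coe_le_norm y)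
  have htoLp : (ContinuousMap.toLp 2 ν ℂ) P = hPL.toLp := by
    refine Lp.ext ?_
    exact (ContinuousMap.coeFn_toLp ν P).trans hPL.coeFn_toLp.symm
  rw [ContinuousLinearMap.coe_coe, htoLp, Lp.edist_toLp_toLp, hν, eLpNorm_map_measure
    (hgr.1.sub hPL.1) hqm.aemeasurable]
  refine eLpNorm_congr_ae ?_
  filter_upwards [hm] with x hx
  have hP2 : P (q x) = c.sum fun j a => a * cexpI j x := by
    have : ∀ j : ℤ, fourier j (q x) = cexpI j x := fun j => by
      rw [hq, fourier_coe_apply, cexpI]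
      congr 1
      have : (Real.pi : ℂ) ≠ 0 := by simp [Real.pi_ne_zero]
      push_cast
      field_simp
    simp only [hPdef, Finsupp.sum, ContinuousMap.coe_sum, Finset.sum_apply, ContinuousMap.coe_smul,
      Pi.smul_apply, smul_eq_mul, this]
  simp only [Function.comp, Pi.sub_apply, hP2, hrq x hx]

namespace Density

variable {T : ℕ} (F : Density T)

/-- The sum of the absolute values of the entries of `f`. -/
def weight (x : ℝ) : ℝ := ∑ ν, ∑ μ, ‖F.toFun x ν μ‖

theorem weight_nonneg (x : ℝ) : 0 ≤ F.weight x := by unfold weight; positivity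

theorem integrable_weight : Integrable F.weight circleVol :=
  integrable_finsetSum _ fun ν _ => integrable_finsetSum _ fun μ _ => (F.integrable ν μ).norm

theorem qform_le_weight (b : ℝ → Fin T → ℂ) (x : ℝ) :
    qform F.toFun b x ≤ F.weight x * ‖b x‖ ^ 2 := by
  have h : qform F.toFun b x = (sform F.toFun b b x).re := rfl
  rw [h, sform_eq_sum, weight, Finset.sum_mul]
  refine (Complex.re_le_norm _).trans ((norm_sum_le _ _).trans (Finset.sum_le_sum fun ν _ => ?_))
  rw [Finset.sum_mul]
  refine (norm_sum_le _ _).trans (Finset.sum_le_sum fun μ _ => ?_)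
  rw [norm_mul, norm_mul, RCLike.norm_conj]
  calc ‖b x ν‖ * ‖F.toFun x ν μ‖ * ‖b x μ‖ ≤ ‖b x‖ * ‖F.toFun x ν μ‖ * ‖b x‖ := by
        gcongr <;> exact norm_le_pi_norm _ _
    _ = _ := by ring

/-- The measure with density `weight` with respect to Lebesgue measure on `(-π, π]`. -/
def weightMeasure : Measure ℝ := circleVol.withDensity fun x => ENNReal.ofReal (F.weight x)

theorem aemeasurable_weight : AEMeasurable (fun x => ENNReal.ofReal (F.weight x)) circleVol :=
  F.integrable_weight.1.aemeasurable.ennreal_ofReal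

instance : IsFiniteMeasure F.weightMeasure :=
  isFiniteMeasure_withDensity_ofReal F.integrable_weight.2

theorem weightMeasure_absolutelyContinuous : F.weightMeasure ≪ circleVol :=
  withDensity_absolutelyContinuous _ _

theorem ae_weightMeasure_mem_Ioc :
    ∀ᵐ x ∂F.weightMeasure, x ∈ Set.Ioc (-Real.pi) Real.pi :=
  F.weightMeasure_absolutelyContinuous.ae_le (ae_restrict_mem measurableSet_Ioc)

variable {F}

theorem memL2_of_memLp {b : ℝ → Fin T → ℂ} (hb : AEStronglyMeasurable b circleVol)
    (h : MemLp b 2 F.weightMeasure) : MemL2 F.toFun b := by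
  refine ⟨hb, ?_⟩
  have hi : Integrable (fun x => ‖b x‖ ^ 2) F.weightMeasure := h.integrable_norm_pow (by norm_num)
  rw [weightMeasure, integrable_withDensity_iff_integrable_smul₀' F.aemeasurable_weight
    (by simp)] at hi
  refine hi.mono' (aestronglyMeasurable_qform F.aestronglyMeasurable hb) ?_
  filter_upwards [F.posSemidef] with x hx
  rw [Real.norm_of_nonneg (qform_nonneg hx b), ENNReal.toReal_ofReal (F.weight_nonneg x)]
  exact F.qform_le_weight b x

/-- The form is dominated by the scalar weight, so approximation in an ordinary $L^2$ space gives
approximation in $L_2(f)$. The factor $2\pi \ge 1$ in the norm is given away. -/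
theorem norm_le_eLpNorm {b : F.L2} (h : MemLp (fn b) 2 F.weightMeasure) :
    ‖b‖ ≤ (eLpNorm (fn b) 2 F.weightMeasure).toReal := by
  have hi : Integrable (fun x => ‖fn b x‖ ^ 2) F.weightMeasure :=
    h.integrable_norm_pow (by norm_num)
  have hint : ∫ x, ‖fn b x‖ ^ 2 ∂F.weightMeasure =
      ∫ x, F.weight x * ‖fn b x‖ ^ 2 ∂circleVol := by
    rw [weightMeasure, integral_withDensity_eq_integral_toReal_smul₀ F.aemeasurable_weight
      (by simp)]
    refine integral_congr_ae (Eventually.of_forall fun x => ?_)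
    simp [ENNReal.toReal_ofReal (F.weight_nonneg x)]
  rw [weightMeasure, integrable_withDensity_iff_integrable_smul₀' F.aemeasurable_weight
    (by simp)] at hi
  have hle : sqNorm F.toFun (fn b) ≤ ∫ x, ‖fn b x‖ ^ 2 ∂F.weightMeasure := by
    rw [hint]
    refine integral_mono (memL2_fn b).2 (hi.congr (Eventually.of_forall fun x => ?_))
      (F.qform_le_weight (fn b))
    simp [ENNReal.toReal_ofReal (F.weight_nonneg x)]
  have h0 : 0 ≤ ∫ x, ‖fn b x‖ ^ 2 ∂F.weightMeasure := integral_nonneg fun x => by positivity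
  rw [h.eLpNorm_eq_integral_rpow_norm (by norm_num) (by norm_num),
    ENNReal.toReal_ofReal (by positivity)]
  simp only [ENNReal.toReal_ofNat, Real.rpow_two]
  rw [← one_div, ← Real.sqrt_eq_rpow]
  refine Real.le_sqrt_of_sq_le (le_trans ?_ hle)
  rw [sqNorm_eq]
  nlinarith [Real.pi_gt_three, sq_nonneg ‖b‖]

theorem memL2_of_bound {b : ℝ → Fin T → ℂ} (hb : AEStronglyMeasurable b circleVol) (C : ℝ)
    (hC : ∀ x, ‖b x‖ ≤ C) : MemL2 F.toFun b :=
  memL2_of_memLp hb (MemLp.of_bound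
    (hb.mono_ac F.weightMeasure_absolutelyContinuous) C (Eventually.of_forall hC))

theorem memL2_simpleFunc (φ : SimpleFunc ℝ (Fin T → ℂ)) : MemL2 F.toFun φ := by
  obtain ⟨C, hC⟩ := φ.exists_forall_norm_le
  exact memL2_of_bound φ.aestronglyMeasurable C hC

/-- A simple function as an element of `L₂(f)`. -/
def ofSimple (F : Density T) (φ : SimpleFunc ℝ (Fin T → ℂ)) : F.L2 := F.elem φ (memL2_simpleFunc φ)

theorem tendsto_iff_sqNorm {ι : Type*} {l : Filter ι} (b : ι → F.L2) (c : F.L2) :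
    Tendsto (fun i => sqNorm F.toFun (fn c - fn (b i))) l (𝓝 0) ↔ Tendsto b l (𝓝 c) := by
  simp only [← fn_sub, sqNorm_eq]
  rw [tendsto_iff_norm_sub_tendsto_zero (f := b)]
  simp only [fun i => norm_sub_rev (b i) c]
  constructor
  · intro h
    have h2 := (h.const_mul (2 * Real.pi)⁻¹).sqrt
    have hpi := Real.pi_ne_zero
    rw [mul_zero, Real.sqrt_zero] at h2
    refine h2.congr fun i => ?_
    rw [inv_mul_cancel_left₀ (by positivity), Real.sqrt_sq (norm_nonneg _)]
  · intro h
    simpa using (h.pow 2).const_mul (2 * Real.pi)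

/-- Bounded functions are dense in `L₂(f)`. -/
theorem exists_bounded_norm_sub_lt (b : F.L2) {ε : ℝ} (hε : 0 < ε) :
    ∃ c : F.L2, (∃ C, ∀ x, ‖fn c x‖ ≤ C) ∧ ‖b - c‖ < ε := by
  -- A scalar damping factor in $[0,1]$, tending to 1, that makes the vector bounded by $n$. Being
  -- scalar, it multiplies the form of the difference by $(1-t)^2$, so the form of `b` dominates.
  set t : ℕ → ℝ → ℝ := fun n x => n / (n + ‖fn b x‖ + 1) with ht
  have ht0 : ∀ n x, 0 ≤ t n x := fun n x => by rw [ht]; positivity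
  have ht1 : ∀ n x, t n x ≤ 1 := fun n x => by
    rw [ht]; exact div_le_one_of_le₀ (by linarith [norm_nonneg (fn b x)]) (by positivity)
  have hbd : ∀ n x, ‖(t n x : ℂ) • fn b x‖ ≤ n := fun n x => by
    rw [norm_smul, Complex.norm_real, Real.norm_of_nonneg (ht0 n x), ht, div_mul_eq_mul_div,
      div_le_iff₀ (by positivity)]
    nlinarith [norm_nonneg (fn b x), (Nat.cast_nonneg n : (0:ℝ) ≤ n)]
  have hmeas : ∀ n, AEStronglyMeasurable (fun x => (t n x : ℂ) • fn b x) circleVol := fun n => by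
    have hcont : Continuous fun v : Fin T → ℂ => (((n : ℝ) / (n + ‖v‖ + 1) : ℝ) : ℂ) • v :=
      (Complex.continuous_ofReal.comp (continuous_const.div (by fun_prop)
        fun v => by positivity)).smul continuous_id
    exact hcont.comp_aestronglyMeasurable (memL2_fn b).1
  set c : ℕ → F.L2 := fun n => F.elem _ (memL2_of_bound (hmeas n) n (hbd n)) with hc
  have hq : ∀ n x, qform F.toFun (fn b - fn (c n)) x = (1 - t n x) ^ 2 * qform F.toFun (fn b) x := by
    intro n x
    have : (fn b - fn (c n)) x = ((1 - t n x : ℝ) : ℂ) • fn b x := by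
      simp [hc, sub_smul]
    rw [qform, qform, this, star_smul, mulVec_smul, dotProduct_smul, smul_dotProduct]
    simp only [smul_eq_mul, RCLike.star_def, Complex.conj_ofReal, Complex.re_ofReal_mul]
    ring
  have hlim : Tendsto c atTop (𝓝 b) := by
    rw [← tendsto_iff_sqNorm]
    have h0 : (0 : ℝ) = ∫ x, (0 : ℝ) ∂circleVol := by simp
    rw [h0]
    refine tendsto_integral_of_dominated_convergence (fun x => qform F.toFun (fn b) x)
      (fun n => aestronglyMeasurable_qform F.aestronglyMeasurable
        ((memL2_fn b).1.sub (memL2_fn (c n)).1)) (memL2_fn b).2 (fun n => ?_)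
      (Eventually.of_forall fun x => ?_)
    · filter_upwards [F.posSemidef] with x hx
      rw [hq, Real.norm_of_nonneg (mul_nonneg (sq_nonneg _) (qform_nonneg hx _))]
      have h1 : (1 - t n x) ^ 2 ≤ 1 := by nlinarith [ht0 n x, ht1 n x]
      nlinarith [qform_nonneg hx (fn b)]
    · simp_rw [hq]
      have h1 : Tendsto (fun n : ℕ => t n x) atTop (𝓝 1) := by
        simp only [ht, add_assoc]
        exact tendsto_natCast_div_add_atTop _
      simpa using ((tendsto_const_nhds (x := (1 : ℝ))).sub h1 |>.pow 2).mul_const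
        (qform F.toFun (fn b) x)
  obtain ⟨n, hn⟩ := (Metric.tendsto_atTop.1 hlim ε hε)
  refine ⟨c n, ⟨n, hbd n⟩, ?_⟩
  have := hn n le_rfl
  rwa [dist_eq_norm, norm_sub_rev] at this

/-- An element of $L_2(f)$ need not be square integrable against the scalar weight, so a bounded
approximation is inserted before the density of simple functions is used. -/
theorem exists_simpleFunc_norm_sub_lt (b : F.L2) {ε : ℝ} (hε : 0 < ε) :
    ∃ φ : SimpleFunc ℝ (Fin T → ℂ), ‖b - F.ofSimple φ‖ < ε := by
  obtain ⟨c, ⟨C, hC⟩, hc⟩ := exists_bounded_norm_sub_lt b (half_pos hε)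
  have hcL : MemLp (fn c) 2 F.weightMeasure := MemLp.of_bound
    ((memL2_fn c).1.mono_ac F.weightMeasure_absolutelyContinuous) C (Eventually.of_forall hC)
  obtain ⟨φ, hφ, hφL⟩ := hcL.exists_simpleFunc_eLpNorm_sub_lt (by norm_num)
    (ε := ENNReal.ofReal (ε / 2)) (by simpa using hε)
  refine ⟨φ, ?_⟩
  have h1 : ‖c - F.ofSimple φ‖ ≤ _ := norm_le_eLpNorm (hcL.sub hφL)
  have h2 := (ENNReal.toReal_lt_of_lt_ofReal hφ)
  calc ‖b - F.ofSimple φ‖ = ‖(b - c) + (c - F.ofSimple φ)‖ := by abel_nf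
    _ ≤ ‖b - c‖ + ‖c - F.ofSimple φ‖ := norm_add_le _ _
    _ < ε / 2 + ε / 2 := add_lt_add hc (h1.trans_lt h2)
    _ = ε := by ring

theorem exists_seq_simpleFunc_tendsto (b : F.L2) :
    ∃ φ : ℕ → SimpleFunc ℝ (Fin T → ℂ), Tendsto (fun n => F.ofSimple (φ n)) atTop (𝓝 b) := by
  choose φ hφ using fun n : ℕ => exists_simpleFunc_norm_sub_lt b (ε := 1 / ((n : ℝ) + 1))
    (by positivity)
  refine ⟨φ, tendsto_iff_norm_sub_tendsto_zero.2 ?_⟩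
  refine squeeze_zero (fun n => norm_nonneg _) (fun n => ?_) tendsto_one_div_add_atTop_nhds_zero_nat
  rw [norm_sub_rev]; exact (hφ n).le

end Density

theorem trigPoly_add {T : ℕ} (p q : ℤ →₀ (Fin T → ℂ)) :
    trigPoly (p + q) = trigPoly p + trigPoly q := by
  ext1 x
  exact Finsupp.sum_add_index' (fun _ => smul_zero _) fun _ _ _ => smul_add _ _ _

theorem trigPoly_smul {T : ℕ} (r : ℂ) (p : ℤ →₀ (Fin T → ℂ)) :
    trigPoly (r • p) = r • trigPoly p := by
  ext1 x
  simp only [trigPoly, Pi.smul_apply]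
  rw [Finsupp.sum_smul_index' fun _ => smul_zero _, Finsupp.smul_sum]
  exact Finsupp.sum_congr fun _ _ => smul_comm _ _ _

theorem trigPoly_single {T : ℕ} (j : ℤ) (v : Fin T → ℂ) (x : ℝ) :
    trigPoly (Finsupp.single j v) x = cexpI j x • v := by
  simp [trigPoly]

namespace Density

variable {T : ℕ} {F : Density T}

theorem memL2_trigPoly (p : ℤ →₀ (Fin T → ℂ)) : MemL2 F.toFun (trigPoly p) := by
  refine memL2_of_bound ?_ (p.sum fun _ v => ‖v‖) fun x => ?_
  · refine Continuous.aestronglyMeasurable ?_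
    unfold trigPoly
    exact continuous_finsetSum _ fun j _ => (continuous_cexpI j).smul continuous_const
  · refine (norm_sum_le _ _).trans (Finset.sum_le_sum fun j _ => ?_)
    simp [norm_smul]

variable (F) in
/-- Trigonometric polynomials as elements of `L₂(f)`. -/
def trig : (ℤ →₀ (Fin T → ℂ)) →ₗ[ℂ] F.L2 where
  toFun p := F.elem (trigPoly p) (memL2_trigPoly p)
  map_add' p q := fn_injective (trigPoly_add p q)
  map_smul' r p := fn_injective (trigPoly_smul r p)

@[simp] theorem fn_trig (p : ℤ →₀ (Fin T → ℂ)) : fn (F.trig p) = trigPoly p := rfl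

/-- Trigonometric polynomials are dense in `L₂(f)`. -/
theorem denseRange_trig : DenseRange F.trig := by
  set K := (LinearMap.range F.trig).topologicalClosure with hK
  -- One bounded coordinate at a time: this is the scalar approximation theorem for the weight
  -- measure.
  have hcoord : ∀ (ν : Fin T) (g : ℝ → ℂ) (hg : Measurable g) (C : ℝ) (_ : ∀ x, ‖g x‖ ≤ C)
      (h : MemL2 F.toFun fun x => Pi.single ν (g x)), F.elem _ h ∈ K := by
    intro ν g hg C hC h
    refine Metric.mem_closure_iff.2 fun ε hε => ?_
    obtain ⟨p, hp⟩ := exists_trigPoly_eLpNorm_sub_lt F.weightMeasure F.ae_weightMeasure_mem_Ioc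
      hg hC (ε := ENNReal.ofReal ε) (by simpa using hε)
    refine ⟨F.trig (p.mapRange (Pi.single ν) (Pi.single_zero ν)), ⟨_, rfl⟩, ?_⟩
    rw [dist_eq_norm]
    have hfn : fn (F.elem _ h - F.trig (p.mapRange (Pi.single ν) (Pi.single_zero ν))) =
        fun x => Pi.single ν (g x - p.sum fun j c => c * cexpI j x) := by
      ext1 x
      rw [fn_sub, fn_elem, fn_trig, Pi.sub_apply, trigPoly,
        Finsupp.sum_mapRange_index (by simp), Pi.single_sub]
      congr 1
      rw [Finsupp.sum, Finsupp.sum, ← LinearMap.single_apply (R := ℂ) (φ := fun _ => ℂ), map_sum]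
      refine Finset.sum_congr rfl fun j _ => ?_
      rw [LinearMap.single_apply, ← Pi.single_smul, smul_eq_mul, mul_comm]
    have hmeas : Measurable fun x => g x - p.sum fun j c => c * cexpI j x :=
      hg.sub (Finset.measurable_sum _ fun j _ => (continuous_cexpI j).measurable.const_mul _)
    have hL : eLpNorm (fun x => (Pi.single ν (g x - p.sum fun j c => c * cexpI j x) : Fin T → ℂ)) 2
        F.weightMeasure < ENNReal.ofReal ε := by
      refine lt_of_le_of_lt (eLpNorm_mono_ae (Eventually.of_forall fun x => ?_)) hp
      rw [Pi.norm_single]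
    have hM : MemLp (fn (F.elem _ h - F.trig (p.mapRange (Pi.single ν) (Pi.single_zero ν)))) 2
        F.weightMeasure := by
      rw [hfn]
      refine ⟨Measurable.aestronglyMeasurable ?_, hL.trans ENNReal.ofReal_lt_top⟩
      exact (measurable_pi_iff.2 fun μ => by
        rcases eq_or_ne μ ν with rfl | h
        · simpa using hmeas
        · simp [h])
    refine (norm_le_eLpNorm hM).trans_lt ?_
    rw [hfn]
    exact ENNReal.toReal_lt_of_lt_ofReal hL
  have hsimple : ∀ φ, F.ofSimple φ ∈ K := by
    intro φ
    obtain ⟨C, hC⟩ := φ.exists_forall_norm_le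
    have hm : ∀ ν, Measurable fun x => φ x ν := fun ν => (measurable_pi_apply ν).comp φ.measurable
    have hmem : ∀ ν, MemL2 F.toFun fun x => Pi.single ν (φ x ν) := fun ν => by
      refine memL2_of_bound (Measurable.aestronglyMeasurable ?_) C fun x => ?_
      · exact (measurable_pi_iff.2 fun μ => by
          rcases eq_or_ne μ ν with rfl | h
          · simpa using hm μ
          · simp [h])
      · rw [Pi.norm_single]; exact (norm_le_pi_norm _ _).trans (hC x)
    have : F.ofSimple φ = ∑ ν, F.elem _ (hmem ν) := by
      refine fn_injective ?_
      rw [← fnₗ_apply (∑ ν, _), map_sum]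
      ext x μ
      simp only [ofSimple, fn_elem, fnₗ_apply, Finset.sum_apply, Finset.sum_pi_single,
        Finset.mem_univ, if_true]
    rw [this]
    exact K.sum_mem fun ν _ => hcoord ν _ (hm ν) C
      (fun x => (norm_le_pi_norm _ _).trans (hC x)) (hmem ν)
  intro b
  have : b ∈ closure (K : Set F.L2) := by
    refine Metric.mem_closure_iff.2 fun ε hε => ?_
    obtain ⟨φ, hφ⟩ := exists_simpleFunc_norm_sub_lt b hε
    exact ⟨_, hsimple φ, by rwa [dist_eq_norm]⟩
  rw [(Submodule.isClosed_topologicalClosure _).closure_eq] at this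
  exact this

end Density

/-! ### The spectral isometry and the orthogonal random measure -/

section Isometry

variable {Ω : Type u} [MeasurableSpace Ω] {P : Measure Ω}

theorem corr_eq_inner (X Y : Lp ℂ 2 P) : corr P X Y = inner ℂ Y X := by
  rw [L2.inner_def]; rfl

theorem mse_eq_norm (X Y : Lp ℂ 2 P) : mse P X Y = ‖X - Y‖ ^ 2 := by
  have h : ((‖X - Y‖ ^ 2 : ℝ) : ℂ) = (mse P X Y : ℂ) := by
    have := inner_self_eq_norm_sq_to_K (𝕜 := ℂ) (X - Y)
    rw [L2.inner_def] at this
    push_cast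
    rw [mse, ← integral_complex_ofReal]
    refine this.symm.trans (integral_congr_ae ?_)
    filter_upwards [Lp.coeFn_sub X Y] with w hw
    rw [hw, inner_self_eq_norm_sq_to_K]
    simp
  exact_mod_cast h.symm

variable {T : ℕ}

/-- The linear combination `∑_j p(j)ᵀ ξ(j)`. -/
def combination (ξ : ℤ → Fin T → Lp ℂ 2 P) : (ℤ →₀ (Fin T → ℂ)) →ₗ[ℂ] Lp ℂ 2 P :=
  Finsupp.lsum ℂ fun j => ∑ ν, (LinearMap.proj ν).smulRight (ξ j ν)

theorem combination_single (ξ : ℤ → Fin T → Lp ℂ 2 P) (j : ℤ) (v : Fin T → ℂ) :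
    combination ξ (Finsupp.single j v) = ∑ ν, v ν • ξ j ν := by
  simp [combination]

theorem combination_apply (ξ : ℤ → Fin T → Lp ℂ 2 P) (p : ℤ →₀ (Fin T → ℂ)) :
    combination ξ p = ∑ j ∈ p.support, ∑ ν, p j ν • ξ j ν := by
  simp [combination, Finsupp.sum]

theorem combination_single_single (ξ : ℤ → Fin T → Lp ℂ 2 P) (j : ℤ) (ν : Fin T) :
    combination ξ (Finsupp.single j (Pi.single ν 1)) = ξ j ν := by
  rw [combination_single]
  simp [Pi.single_apply, ite_smul]

theorem integrable_cexpI_mul {g : ℝ → ℂ} (hg : Integrable g circleVol) (n : ℤ) :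
    Integrable (fun x => cexpI n x * g x) circleVol :=
  hg.bdd_mul (continuous_cexpI n).aestronglyMeasurable (Eventually.of_forall fun x =>
    (norm_cexpI n x).le)

theorem cexpI_sub (k j : ℤ) (x : ℝ) :
    cexpI (k - j) x = cexpI k x * (starRingEnd ℂ) (cexpI j x) := by
  simp only [cexpI]
  rw [← Complex.exp_conj, ← Complex.exp_add]
  congr 1
  simp
  ring

variable {ξ : ℤ → Fin T → Lp ℂ 2 P} {f : ℝ → Matrix (Fin T) (Fin T) ℂ}

/-- The density bundled with its properties. -/
def IsSpectralDensity.density (hf : IsSpectralDensity P ξ f) : Density T :=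
  ⟨f, hf.integrable, hf.posSemidef⟩

@[simp] theorem IsSpectralDensity.density_toFun (hf : IsSpectralDensity P ξ f) :
    hf.density.toFun = f := rfl

/-- The covariance at lag $k-j$ is a Fourier integral of $f$, and $e^{i(k-j)x} =
e^{ikx}\overline{e^{ijx}}$. Bilinearity then gives the isometry on all polynomials. -/
theorem IsSpectralDensity.inner_combination_single (hf : IsSpectralDensity P ξ f) (j k : ℤ)
    (v w : Fin T → ℂ) :
    inner ℂ (combination ξ (Finsupp.single j v)) (combination ξ (Finsupp.single k w)) =
      inner ℂ (hf.density.trig (Finsupp.single j v)) (hf.density.trig (Finsupp.single k w)) := by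
  rw [combination_single, combination_single, Density.inner_eq]
  simp only [sum_inner, inner_sum, inner_smul_left, inner_smul_right, ← corr_eq_inner]
  have hcov : ∀ ν μ, corr P (ξ k μ) (ξ j ν) =
      (2 * Real.pi : ℂ)⁻¹ * ∫ x, cexpI (k - j) x * f x μ ν ∂circleVol := by
    intro ν μ
    rw [← hf.cov j (k - j) μ ν, add_sub_cancel]
  have hint : ∀ x, sform f (trigPoly (Finsupp.single j v)) (trigPoly (Finsupp.single k w)) x =
      ∑ ν, ∑ μ, w ν * (starRingEnd ℂ) (v μ) * (cexpI (k - j) x * f x ν μ) := by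
    intro x
    rw [sform_eq_sum]
    refine Finset.sum_congr rfl fun ν _ => Finset.sum_congr rfl fun μ _ => ?_
    rw [trigPoly_single, trigPoly_single, cexpI_sub]
    simp only [Pi.smul_apply, smul_eq_mul, map_mul]
    ring
  simp only [hf.density_toFun, Density.fn_trig, hint, hcov]
  rw [integral_finsetSum _ fun ν _ => integrable_finsetSum _ fun μ _ =>
    (integrable_cexpI_mul (hf.integrable ν μ) _).const_mul _, Finset.mul_sum]
  refine Finset.sum_congr rfl fun ν _ => ?_
  rw [integral_finsetSum _ fun μ _ => (integrable_cexpI_mul (hf.integrable ν μ) _).const_mul _,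
    Finset.mul_sum, Finset.mul_sum]
  refine Finset.sum_congr rfl fun μ _ => ?_
  rw [integral_const_mul]
  ring

theorem IsSpectralDensity.inner_combination (hf : IsSpectralDensity P ξ f)
    (p q : ℤ →₀ (Fin T → ℂ)) :
    inner ℂ (combination ξ p) (combination ξ q) =
      inner ℂ (hf.density.trig p) (hf.density.trig q) := by
  induction p using Finsupp.induction_linear with
  | zero => simp
  | add p p' h h' => rw [map_add, map_add, inner_add_left, inner_add_left, h, h']
  | single j v =>
    induction q using Finsupp.induction_linear with
    | zero => simp
    | add q q' h h' => rw [map_add, map_add, inner_add_right, inner_add_right, h, h']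
    | single k w => exact hf.inner_combination_single j k v w

theorem IsSpectralDensity.norm_combination (hf : IsSpectralDensity P ξ f)
    (p : ℤ →₀ (Fin T → ℂ)) : ‖combination ξ p‖ = ‖hf.density.trig p‖ := by
  rw [norm_eq_sqrt_re_inner (𝕜 := ℂ), norm_eq_sqrt_re_inner (𝕜 := ℂ), hf.inner_combination]

/-- The isometry `L₂(f) → L²(P)` that maps `e^{ijx} δ_ν` to `ξ_ν(j)`. -/
def IsSpectralDensity.isometry (hf : IsSpectralDensity P ξ f) :
    hf.density.L2 →ₗᵢ[ℂ] Lp ℂ 2 P where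
  toLinearMap := ((combination ξ).extendOfNorm hf.density.trig).toLinearMap
  norm_map' b := by
    refine (Density.denseRange_trig (F := hf.density)).induction_on b
      (isClosed_eq ((ContinuousLinearMap.continuous _).norm) continuous_norm) fun p => ?_
    rw [ContinuousLinearMap.coe_coe, LinearMap.extendOfNorm_eq Density.denseRange_trig
      ⟨1, fun p => by rw [one_mul, hf.norm_combination]⟩, hf.norm_combination]

theorem IsSpectralDensity.isometry_trig (hf : IsSpectralDensity P ξ f)
    (p : ℤ →₀ (Fin T → ℂ)) : hf.isometry (hf.density.trig p) = combination ξ p :=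
  LinearMap.extendOfNorm_eq Density.denseRange_trig
    ⟨1, fun p => by rw [one_mul, hf.norm_combination]⟩ p

namespace Density

variable (F : Density T)

theorem memL2_indicator (ν : Fin T) {Δ : Set ℝ} (hΔ : MeasurableSet Δ) :
    MemL2 F.toFun fun x => Pi.single ν (Δ.indicator 1 x) := by
  refine memL2_of_bound (Measurable.aestronglyMeasurable ?_) 1 fun x => ?_
  · exact measurable_pi_iff.2 fun μ => by
      rcases eq_or_ne μ ν with rfl | h
      · simpa using measurable_one.indicator hΔ
      · simp [h]
  · rw [Pi.norm_single]
    exact (norm_indicator_le_norm_self _ _).trans (by simp)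

/-- The function `1_Δ δ_ν` as an element of `L₂(f)`. -/
def indicator (ν : Fin T) {Δ : Set ℝ} (hΔ : MeasurableSet Δ) : F.L2 :=
  F.elem _ (F.memL2_indicator ν hΔ)

variable {F}

theorem inner_indicator (ν μ : Fin T) {Δ Δ' : Set ℝ} (hΔ : MeasurableSet Δ)
    (hΔ' : MeasurableSet Δ') : inner ℂ (F.indicator μ hΔ') (F.indicator ν hΔ) =
      (2 * Real.pi : ℂ)⁻¹ * ∫ x in Δ ∩ Δ', F.toFun x ν μ ∂circleVol := by
  rw [inner_eq, ← integral_indicator (hΔ.inter hΔ')]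
  congr 2
  ext x
  rw [sform_eq_sum, Finset.sum_eq_single ν, Finset.sum_eq_single μ]
  · by_cases h : x ∈ Δ <;> by_cases h' : x ∈ Δ' <;> simp [indicator, h, h']
  · intro κ _ h; simp [indicator, h]
  · simp
  · intro κ _ h; simp [indicator, h]
  · simp

theorem ofSimple_eq_sum (φ : SimpleFunc ℝ (Fin T → ℂ)) :
    F.ofSimple φ = ∑ v ∈ φ.range, ∑ ν, v ν • F.indicator ν (φ.measurableSet_fiber v) := by
  refine fn_injective ?_
  rw [← fnₗ_apply (∑ v ∈ _, _), map_sum]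
  ext x μ
  simp only [ofSimple, fn_elem, map_sum, map_smul, fnₗ_apply, indicator, Finset.sum_apply,
    Pi.smul_apply, smul_eq_mul]
  rw [Finset.sum_eq_single (φ x), Finset.sum_eq_single μ]
  · simp
  · intro κ _ h; simp [h.symm]
  · simp
  · intro v _ h
    have : x ∉ φ ⁻¹' {v} := fun hx => h (by simpa using Eq.symm hx)
    simp [Set.indicator_of_notMem this]
  · intro h; exact absurd (φ.mem_range_self x) h

end Density

variable {Z : Fin T → Set ℝ → Lp ℂ 2 P}

theorem simpleIntegral_eq_isometry (hf : IsSpectralDensity P ξ f)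
    (hZ : ∀ ν Δ, ∀ hΔ : MeasurableSet Δ, Z ν Δ = hf.isometry (hf.density.indicator ν hΔ))
    (φ : SimpleFunc ℝ (Fin T → ℂ)) :
    simpleIntegral P Z φ = hf.isometry (hf.density.ofSimple φ) := by
  rw [Density.ofSimple_eq_sum, simpleIntegral]
  simp only [map_sum, map_smul, ← hZ]

/-- On simple functions the integral is the isometry; continuity fixes the limit for every
approximating sequence, and density of simple functions supplies one. -/
theorem isStochIntegral_iff (hf : IsSpectralDensity P ξ f)
    (hZ : ∀ ν Δ, ∀ hΔ : MeasurableSet Δ, Z ν Δ = hf.isometry (hf.density.indicator ν hΔ))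
    {h : ℝ → Fin T → ℂ} (hh : MemL2 f h) (Y : Lp ℂ 2 P) :
    IsStochIntegral P f Z h Y ↔ Y = hf.isometry (hf.density.elem h hh) := by
  have hlim : ∀ φ : ℕ → SimpleFunc ℝ (Fin T → ℂ),
      Tendsto (fun n => sqNorm f (fun x => h x - φ n x)) atTop (𝓝 0) ↔
        Tendsto (fun n => hf.density.ofSimple (φ n)) atTop (𝓝 (hf.density.elem h hh)) :=
    fun φ => Density.tendsto_iff_sqNorm (F := hf.density) (fun n => hf.density.ofSimple (φ n))
      (hf.density.elem h hh)
  simp only [IsStochIntegral, simpleIntegral_eq_isometry hf hZ, hlim]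
  constructor
  · rintro ⟨-, φ, h1, h2⟩
    exact tendsto_nhds_unique h2 ((hf.isometry.continuous.tendsto _).comp h1)
  · rintro rfl
    obtain ⟨φ, hφ⟩ := Density.exists_seq_simpleFunc_tendsto (hf.density.elem h hh)
    exact ⟨hh, φ, hφ, (hf.isometry.continuous.tendsto _).comp hφ⟩

theorem trigPoly_single_single (n : ℤ) (ν : Fin T) :
    trigPoly (Finsupp.single n (Pi.single ν 1)) = fun x => Pi.single ν (cexpI n x) := by
  ext1 x
  rw [trigPoly_single, ← Pi.single_smul, smul_eq_mul, mul_one]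

theorem IsSpectralDensity.exists_randomMeasure (hf : IsSpectralDensity P ξ f) :
    ∃ Z, IsOrthogonalRandomMeasure P ξ f Z := by
  classical
  -- The value 0 on nonmeasurable sets is arbitrary: only measurable sets enter the covariance and
  -- the fibres of simple functions.
  set Z : Fin T → Set ℝ → Lp ℂ 2 P := fun ν Δ =>
    if hΔ : MeasurableSet Δ then hf.isometry (hf.density.indicator ν hΔ) else 0 with hZdef
  have hZ : ∀ ν Δ, ∀ hΔ : MeasurableSet Δ, Z ν Δ = hf.isometry (hf.density.indicator ν hΔ) :=
    fun ν Δ hΔ => dif_pos hΔ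
  refine ⟨Z, fun ν μ Δ Δ' hΔ hΔ' => ?_, fun n ν => ?_⟩
  · rw [hZ ν Δ hΔ, hZ μ Δ' hΔ', corr_eq_inner, LinearIsometry.inner_map_map,
      Density.inner_indicator, hf.density_toFun]
  · rw [← trigPoly_single_single,
      isStochIntegral_iff hf hZ (Density.memL2_trigPoly (F := hf.density) _)]
    exact (combination_single_single ξ n ν).symm.trans (hf.isometry_trig _).symm

/-- The covariance fixes the inner products of $Z(\Delta)$ with simple integrals, hence with their
limits $\xi_\mu(n)$, hence with the range of $V$. All four terms of
$\|Z_\nu(\Delta)-V(1_\Delta\delta_\nu)\|^2$ are then equal up to sign and cancel. Additivity of $Z$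
is not presupposed. -/
theorem IsOrthogonalRandomMeasure.eq_isometry (hf : IsSpectralDensity P ξ f)
    (hZ : IsOrthogonalRandomMeasure P ξ f Z) (ν : Fin T) (Δ : Set ℝ) (hΔ : MeasurableSet Δ) :
    Z ν Δ = hf.isometry (hf.density.indicator ν hΔ) := by
  have hcov : ∀ (μ : Fin T) (Δ' : Set ℝ) (hΔ' : MeasurableSet Δ'), inner ℂ (Z μ Δ') (Z ν Δ) =
      inner ℂ (hf.density.indicator μ hΔ') (hf.density.indicator ν hΔ) := by
    intro μ Δ' hΔ'
    rw [← corr_eq_inner, hZ.cov ν μ Δ Δ' hΔ hΔ', Density.inner_indicator, hf.density_toFun]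
  have hsimple : ∀ φ : SimpleFunc ℝ (Fin T → ℂ), inner ℂ (simpleIntegral P Z φ) (Z ν Δ) =
      inner ℂ (hf.density.ofSimple φ) (hf.density.indicator ν hΔ) := by
    intro φ
    rw [Density.ofSimple_eq_sum, simpleIntegral]
    simp only [sum_inner, inner_smul_left]
    refine Finset.sum_congr rfl fun v _ => Finset.sum_congr rfl fun μ _ => ?_
    rw [hcov μ _ (φ.measurableSet_fiber v)]
  have hbase : ∀ (n : ℤ) (μ : Fin T), inner ℂ (ξ n μ) (Z ν Δ) =
      inner ℂ (hf.density.trig (Finsupp.single n (Pi.single μ 1)))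
        (hf.density.indicator ν hΔ) := by
    intro n μ
    obtain ⟨-, φ, h1, h2⟩ := hZ.repr n μ
    rw [← trigPoly_single_single] at h1
    have h1' : Tendsto (fun k => hf.density.ofSimple (φ k)) atTop
        (𝓝 (hf.density.trig (Finsupp.single n (Pi.single μ 1)))) :=
      (Density.tendsto_iff_sqNorm (F := hf.density) (fun k => hf.density.ofSimple (φ k))
        (hf.density.trig (Finsupp.single n (Pi.single μ 1)))).1 h1
    refine tendsto_nhds_unique (h2.inner (𝕜 := ℂ) tendsto_const_nhds) ?_
    simp only [hsimple]
    exact h1'.inner tendsto_const_nhds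
  have hall : ∀ b : hf.density.L2, inner ℂ (hf.isometry b) (Z ν Δ) =
      inner ℂ b (hf.density.indicator ν hΔ) := by
    intro b
    refine (Density.denseRange_trig (F := hf.density)).induction_on b
      (isClosed_eq (hf.isometry.continuous.inner continuous_const)
        (continuous_id.inner continuous_const)) fun p => ?_
    rw [hf.isometry_trig]
    induction p using Finsupp.induction_linear with
    | zero => simp
    | add p q hp hq => rw [map_add, map_add, inner_add_left, inner_add_left, hp, hq]
    | single n v =>
      have hv : Finsupp.single n v = ∑ μ, v μ • Finsupp.single n (Pi.single μ (1 : ℂ)) := by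
        simp only [Finsupp.smul_single, ← Finsupp.single_finsetSum]
        congr 1
        ext κ
        simp [Pi.single_apply]
      rw [hv]
      simp only [map_sum, map_smul, sum_inner, inner_smul_left, combination_single_single, hbase]
  rw [← sub_eq_zero, ← inner_self_eq_zero (𝕜 := ℂ), inner_sub_left, inner_sub_right,
    inner_sub_right, hall, hcov ν Δ hΔ, LinearIsometry.inner_map_map,
    ← inner_conj_symm (Z ν Δ), hall, inner_conj_symm]
  ring

end Isometry

/-! ### Blocks -/

section Blocks

theorem blockStart_succ (N K : ℕ → ℕ) (l : ℕ) :
    blockStart N K (l + 1) = blockStart N K l + (N (l + 1) + K (l + 1)) :=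
  Finset.sum_range_succ _ _

theorem blockStart_mono (N K : ℕ → ℕ) : Monotone (blockStart N K) :=
  monotone_nat_of_le_succ fun l => by rw [blockStart_succ]; omega

theorem disjoint_block (N K : ℕ → ℕ) {l l' : ℕ} (h : l < l') :
    Disjoint (block N K l) (block N K l') := by
  rw [Finset.disjoint_left]
  intro j hj hj'
  simp only [block, Finset.mem_Icc] at hj hj'
  have h1 := blockStart_mono N K (Nat.succ_le_of_lt h)
  rw [Nat.succ_eq_add_one, blockStart_succ] at h1
  omega

/-- The blocks are disjoint, so no index is counted twice. -/
theorem blockSum_eq_sum_missing {E : Type*} [AddCommMonoid E] (N K : ℕ → ℕ) (s : ℕ) (g : ℤ → E) :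
    blockSum N K s g = ∑ j ∈ missing N K s, g j := by
  rw [missing, Finset.sum_biUnion, blockSum]
  intro l _ l' _ hne
  rcases lt_or_gt_of_ne hne with h | h
  · exact disjoint_block N K h
  · exact (disjoint_block N K h).symm

end Blocks

/-! ### The dual system -/

section Inverse

variable {T : ℕ} {F : Density T}

/-- Adjugate and determinant are continuous in the entries; inversion of scalars is measurable, with
$0^{-1}=0$. -/
theorem aemeasurable_inv_apply {f : ℝ → Matrix (Fin T) (Fin T) ℂ}
    (hf : ∀ ν μ, AEMeasurable (fun x => f x ν μ) circleVol) (ν μ : Fin T) :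
    AEMeasurable (fun x => (f x)⁻¹ ν μ) circleVol := by
  have hpi : AEMeasurable (fun x ν μ => f x ν μ) circleVol :=
    aemeasurable_pi_lambda _ fun ν => aemeasurable_pi_lambda _ fun μ => hf ν μ
  have hof : Continuous fun A : Fin T → Fin T → ℂ => Matrix.of A := continuous_id
  have hdet : Continuous fun A : Fin T → Fin T → ℂ => (Matrix.of A).det := hof.matrix_det
  have hadj : Continuous fun A : Fin T → Fin T → ℂ => (Matrix.of A).adjugate ν μ :=
    hof.matrix_adjugate.matrix_elem ν μ
  have heq : (fun x => (f x)⁻¹ ν μ) = fun x => ((f x).det)⁻¹ * (f x).adjugate ν μ := by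
    ext x
    rw [Matrix.inv_def, Matrix.smul_apply, Ring.inverse_eq_inv', smul_eq_mul]
  rw [heq]
  exact (hdet.measurable.comp_aemeasurable hpi).inv.mul (hadj.measurable.comp_aemeasurable hpi)

/-- The bound on the form at unit vectors controls an entry by two diagonal entries, each at most
the trace. Thus an integrable trace of $f^{-1}$ makes all its entries integrable. -/
theorem norm_apply_le_two_mul_trace {A : Matrix (Fin T) (Fin T) ℂ} (hA : A.PosSemidef)
    (ν μ : Fin T) : ‖A ν μ‖ ≤ 2 * ‖A.trace‖ := by
  have h := norm_sform_le (f := fun _ => A) (x := 0) hA (fun _ => Pi.single μ 1)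
    (fun _ => Pi.single ν 1)
  have hd : ∀ κ, qform (fun _ => A) (fun _ => Pi.single κ 1) 0 ≤ ‖A.trace‖ := by
    intro κ
    have h1 : qform (fun _ => A) (fun _ => Pi.single κ 1) 0 = (A κ κ).re := by
      simp [qform, Pi.star_single]
    rw [h1, Matrix.trace]
    refine le_trans ?_ (Complex.re_le_norm _)
    rw [Complex.re_sum]
    exact Finset.single_le_sum (f := fun i => (A i i).re)
      (fun i _ => (Complex.nonneg_iff.1 hA.diag_nonneg).1) (Finset.mem_univ κ)
  have h2 : sform (fun _ => A) (fun _ => Pi.single μ 1) (fun _ => Pi.single ν 1) 0 = A ν μ := by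
    simp [sform, Pi.star_single]
  rw [h2] at h
  linarith [hd ν, hd μ]

/-- The inverse of a spectral density satisfying the minimality condition. -/
def MinimalityCondition.inv (hm : MinimalityCondition F.toFun) : Density T where
  toFun x := (F.toFun x)⁻¹
  integrable ν μ := by
    refine (hm.2.norm.const_mul 2).mono'
      (aemeasurable_inv_apply (fun ν μ => (F.integrable ν μ).1.aemeasurable) ν
        μ).aestronglyMeasurable ?_
    filter_upwards [F.posSemidef] with x hx using norm_apply_le_two_mul_trace hx.inv ν μ
  posSemidef := by filter_upwards [F.posSemidef] with x hx using hx.inv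

@[simp] theorem MinimalityCondition.inv_toFun (hm : MinimalityCondition F.toFun) (x : ℝ) :
    hm.inv.toFun x = (F.toFun x)⁻¹ := rfl

theorem sform_vecMul_inv {f : ℝ → Matrix (Fin T) (Fin T) ℂ} {x : ℝ} (hx : (f x).PosSemidef)
    (hu : IsUnit (f x).det) (C b : ℝ → Fin T → ℂ) :
    sform f (fun x => C x ᵥ* (f x)⁻¹) b x = b x ⬝ᵥ star (C x) := by
  rw [sform, star_vecMul, hx.inv.1.eq, mulVec_mulVec, Matrix.mul_nonsing_inv _ hu, one_mulVec]

theorem qform_vecMul_inv {f : ℝ → Matrix (Fin T) (Fin T) ℂ} {x : ℝ} (hx : (f x).PosSemidef)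
    (hu : IsUnit (f x).det) (C : ℝ → Fin T → ℂ) :
    qform f (fun x => C x ᵥ* (f x)⁻¹) x = qform (fun x => (f x)⁻¹) C x := by
  have h := sform_vecMul_inv hx hu C (fun x => C x ᵥ* (f x)⁻¹)
  have h1 : qform f (fun x => C x ᵥ* (f x)⁻¹) x =
    (sform f (fun x => C x ᵥ* (f x)⁻¹) (fun x => C x ᵥ* (f x)⁻¹) x).re := rfl
  rw [h1, h, ← dotProduct_mulVec]; rfl

theorem MinimalityCondition.memL2_vecMul_inv (hm : MinimalityCondition F.toFun)
    (C : hm.inv.L2) : MemL2 F.toFun fun x => Density.fn C x ᵥ* (F.toFun x)⁻¹ := by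
  obtain ⟨hC1, hC2⟩ := Density.memL2_fn C
  refine ⟨?_, hC2.congr ?_⟩
  · refine AEMeasurable.aestronglyMeasurable (aemeasurable_pi_lambda _ fun μ => ?_)
    simp only [vecMul, dotProduct]
    refine Finset.aemeasurable_fun_sum _ fun ν _ => ?_
    exact ((measurable_pi_apply ν).comp_aemeasurable hC1.aemeasurable).mul
      (hm.inv.aestronglyMeasurable ν μ).aemeasurable
  · filter_upwards [F.posSemidef, hm.1] with x hx hu using (qform_vecMul_inv hx hu _).symm

/-- The map `C ↦ Cᵀ f⁻¹` from `L₂(f⁻¹)` to `L₂(f)`. -/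
def MinimalityCondition.dual (hm : MinimalityCondition F.toFun) : hm.inv.L2 →ₗ[ℂ] F.L2 where
  toFun C := F.elem _ (hm.memL2_vecMul_inv C)
  map_add' C D := Density.fn_injective <| funext fun x => by simp [add_vecMul]
  map_smul' r C := Density.fn_injective <| funext fun x => by simp [smul_vecMul]

@[simp] theorem MinimalityCondition.fn_dual (hm : MinimalityCondition F.toFun) (C : hm.inv.L2) :
    Density.fn (hm.dual C) = fun x => Density.fn C x ᵥ* (F.toFun x)⁻¹ := rfl

/-- The weight cancels against its inverse, leaving the unweighted pairing, for which exponentials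
are orthonormal. -/
theorem MinimalityCondition.inner_dual (hm : MinimalityCondition F.toFun) (C : hm.inv.L2)
    (b : F.L2) : inner ℂ (hm.dual C) b =
      (2 * Real.pi : ℂ)⁻¹ * ∫ x, Density.fn b x ⬝ᵥ star (Density.fn C x) ∂circleVol := by
  rw [Density.inner_eq]
  congr 1
  refine integral_congr_ae ?_
  filter_upwards [F.posSemidef, hm.1] with x hx hu using sform_vecMul_inv hx hu _ _

theorem MinimalityCondition.inner_dual_dual (hm : MinimalityCondition F.toFun)
    (C D : hm.inv.L2) : inner ℂ (hm.dual C) (hm.dual D) = inner ℂ C D := by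
  rw [hm.inner_dual, Density.inner_eq]
  simp only [hm.fn_dual, ← dotProduct_mulVec]
  rfl

theorem integral_cexpI (n : ℤ) :
    (2 * Real.pi : ℂ)⁻¹ * ∫ x, cexpI n x ∂circleVol = if n = 0 then 1 else 0 := by
  have hpi : (2 * Real.pi : ℂ) ≠ 0 := by simp [Real.pi_ne_zero]
  rw [circleVol, ← intervalIntegral.integral_of_le (by linarith [Real.pi_pos])]
  split_ifs with h
  · subst h
    simp only [cexpI, Int.cast_zero, mul_zero, zero_mul, Complex.exp_zero]
    rw [intervalIntegral.integral_const, sub_neg_eq_add, ← two_mul, Complex.real_smul, mul_one]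
    push_cast
    exact inv_mul_cancel₀ hpi
  · have hc : (Complex.I * n : ℂ) ≠ 0 := mul_ne_zero Complex.I_ne_zero (by exact_mod_cast h)
    simp only [cexpI]
    rw [integral_exp_mul_complex hc]
    have : Complex.exp (Complex.I * n * (Real.pi : ℝ)) =
        Complex.exp (Complex.I * n * ((-Real.pi : ℝ) : ℂ)) := by
      rw [Complex.exp_eq_exp_iff_exists_int]
      exact ⟨n, by push_cast; ring⟩
    rw [this, sub_self, zero_div, mul_zero]

/-- The dual system is biorthogonal to the exponentials. -/
theorem MinimalityCondition.inner_dual_trig (hm : MinimalityCondition F.toFun)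
    (p q : ℤ →₀ (Fin T → ℂ)) : inner ℂ (hm.dual (hm.inv.trig p)) (F.trig q) =
      q.sum fun j w => w ⬝ᵥ star (p j) := by
  induction q using Finsupp.induction_linear with
  | zero => simp
  | add q q' h h' =>
    rw [map_add, inner_add_right, h, h', Finsupp.sum_add_index'] <;> simp [add_dotProduct]
  | single j w =>
    rw [Finsupp.sum_single_index (by simp)]
    induction p using Finsupp.induction_linear with
    | zero => simp
    | add p p' h h' => simp [map_add, inner_add_left, h, h', dotProduct_add]
    | single k v =>
      rw [hm.inner_dual]
      have : ∀ x, trigPoly (Finsupp.single j w) x ⬝ᵥ star (trigPoly (Finsupp.single k v) x) =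
          cexpI (j - k) x * (w ⬝ᵥ star v) := by
        intro x
        rw [trigPoly_single, trigPoly_single, cexpI_sub]
        simp [star_smul, mul_assoc]
        ring
      simp only [Density.fn_trig, this]
      rw [integral_mul_const, ← mul_assoc, integral_cexpI]
      rcases eq_or_ne j k with rfl | h
      · simp
      · simp [sub_eq_zero, h]

end Inverse

/-! ### The matrix `B_s` and the spectral characteristic -/

section Interpolation

variable {T : ℕ} {F : Density T} {S : Finset ℤ}

/-- The coefficient sequence supported on `S` with a given stacked vector. -/
def unstack (S : Finset ℤ) : (S × Fin T → ℂ) →ₗ[ℂ] (ℤ →₀ (Fin T → ℂ)) :=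
  ∑ k : S × Fin T, (LinearMap.proj k).smulRight (Finsupp.single (k.1 : ℤ) (Pi.single k.2 1))

theorem unstack_eq_sum (v : S × Fin T → ℂ) :
    unstack S v = ∑ k : S × Fin T, v k • Finsupp.single (k.1 : ℤ) (Pi.single k.2 1) := by
  simp [unstack]

theorem unstack_eq_sum_single (u : ℤ → Fin T → ℂ) :
    unstack S (fun k => u k.1 k.2) = ∑ j ∈ S, Finsupp.single j (u j) := by
  rw [unstack_eq_sum, Fintype.sum_prod_type, ← Finset.sum_coe_sort S]
  refine Finset.sum_congr rfl fun j _ => ?_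
  simp only [Finsupp.smul_single, ← Finsupp.single_finsetSum]
  congr 1
  ext κ
  simp [Pi.single_apply]

theorem unstack_apply_of_mem (v : S × Fin T → ℂ) (k : S × Fin T) :
    unstack S v (k.1 : ℤ) k.2 = v k := by
  classical
  rw [unstack_eq_sum, Finsupp.finsetSum_apply, Finset.sum_apply, Finset.sum_eq_single k]
  · simp
  · rintro ⟨j, ν⟩ _ hne
    rcases eq_or_ne (j : ℤ) k.1 with h | h
    · have hν : k.2 ≠ ν := fun hν => hne (Prod.ext (Subtype.ext h) hν.symm)
      simp [h, hν]
    · simp [h]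
  · simp

theorem unstack_apply_of_notMem (v : S × Fin T → ℂ) {j : ℤ} (hj : j ∉ S) :
    unstack S v j = 0 := by
  rw [unstack_eq_sum, Finsupp.finsetSum_apply]
  refine Finset.sum_eq_zero fun k _ => ?_
  have : (k.1 : ℤ) ≠ j := fun h => hj (h ▸ k.1.2)
  simp [this]

theorem trigPoly_unstack (u : ℤ → Fin T → ℂ) (x : ℝ) :
    trigPoly (unstack S fun k => u k.1 k.2) x = ∑ j ∈ S, cexpI j x • u j := by
  have h : trigPoly (∑ j ∈ S, Finsupp.single j (u j)) =
      ∑ j ∈ S, trigPoly (Finsupp.single j (u j)) :=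
    map_sum (AddMonoidHom.mk' (trigPoly (T := T)) trigPoly_add) _ _
  rw [unstack_eq_sum_single, h, Finset.sum_apply]
  simp only [trigPoly_single]

namespace MinimalityCondition

variable (hm : MinimalityCondition F.toFun)

/-- So $B_s$ is a Gram matrix in $L_2(f^{-1})$. The transpose in its definition appears because the
form places the second argument on the left. -/
theorem matB_apply (k j : S × Fin T) : matB S F.toFun k j =
    inner ℂ (hm.inv.trig (Finsupp.single (k.1 : ℤ) (Pi.single k.2 1)))
      (hm.inv.trig (Finsupp.single (j.1 : ℤ) (Pi.single j.2 1))) := by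
  rw [matB, Density.inner_eq]
  congr 2
  ext x
  rw [sform, Density.fn_trig, Density.fn_trig, trigPoly_single, trigPoly_single, cexpI_sub]
  simp [Pi.star_single, mulVec_smul]
  ring

theorem matB_mulVec (v : S × Fin T → ℂ) (k : S × Fin T) : (matB S F.toFun *ᵥ v) k =
    inner ℂ (hm.inv.trig (Finsupp.single (k.1 : ℤ) (Pi.single k.2 1)))
      (hm.inv.trig (unstack S v)) := by
  rw [unstack_eq_sum, map_sum, inner_sum, mulVec, dotProduct]
  refine Finset.sum_congr rfl fun j _ => ?_
  rw [map_smul, inner_smul_right, hm.matB_apply, mul_comm]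

theorem inner_trig_unstack (v w : S × Fin T → ℂ) :
    inner ℂ (hm.inv.trig (unstack S v)) (hm.inv.trig (unstack S w)) =
      star v ⬝ᵥ (matB S F.toFun *ᵥ w) := by
  rw [unstack_eq_sum v, map_sum, sum_inner, dotProduct]
  refine Finset.sum_congr rfl fun j _ => ?_
  rw [map_smul, inner_smul_left, hm.matB_mulVec]
  simp

/-- Taking a coefficient of a polynomial is therefore continuous in the norm of $L_2(f)$. -/
theorem inner_dual_single_trig (k : ℤ) (μ : Fin T) (p : ℤ →₀ (Fin T → ℂ)) :
    inner ℂ (hm.dual (hm.inv.trig (Finsupp.single k (Pi.single μ 1)))) (F.trig p) = p k μ := by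
  rw [hm.inner_dual_trig, Finsupp.sum, Finset.sum_eq_single k]
  · simp [Pi.star_single]
  · intro j _ h
    simp [h.symm]
  · intro h
    simp [Finsupp.notMem_support_iff.1 h]

/-- A vector in the kernel of the Gram matrix gives a dual combination of norm zero. Pairing it with
exponentials recovers its coefficients up to conjugation, so by Cauchy–Schwarz they vanish; in a
seminormed space norm zero alone would not suffice. -/
theorem isUnit_det_matB (hm : MinimalityCondition F.toFun) :
    IsUnit (matB S F.toFun).det := by
  classical
  rw [← isUnit_iff_isUnit_det, ← mulVec_injective_iff_isUnit]
  refine (injective_iff_map_eq_zero (matB S F.toFun).mulVecLin).2 fun v hv => ?_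
  rw [mulVecLin_apply] at hv
  have h0 : ‖hm.dual (hm.inv.trig (unstack S v))‖ = 0 := by
    have h := inner_self_eq_norm_sq_to_K (𝕜 := ℂ) (hm.dual (hm.inv.trig (unstack S v)))
    rw [hm.inner_dual_dual, hm.inner_trig_unstack, hv, dotProduct_zero] at h
    simpa using h.symm
  ext k
  have h1 := norm_inner_le_norm (𝕜 := ℂ) (hm.dual (hm.inv.trig (unstack S v)))
    (F.trig (Finsupp.single (k.1 : ℤ) (Pi.single k.2 1)))
  rw [h0, zero_mul, hm.inner_dual_trig, Finsupp.sum_single_index (by simp)] at h1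
  simpa [unstack_apply_of_mem] using h1

theorem matB_mulVec_stackC (hm : MinimalityCondition F.toFun) (a : ℤ → ℂ) :
    matB S F.toFun *ᵥ stackC S F.toFun a = stackA T S a := by
  rw [stackC, mulVec_mulVec, Matrix.mul_nonsing_inv _ hm.isUnit_det_matB, one_mulVec]

variable (a : ℤ → ℂ)

variable (S) in
/-- The spectral characteristic as an element of `L₂(f)`. -/
def charL2 : F.L2 :=
  F.trig (unstack S (stackA T S a)) - hm.dual (hm.inv.trig (unstack S (stackC S F.toFun a)))

theorem fn_charL2 (N K : ℕ → ℕ) (s : ℕ) :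
    Density.fn (hm.charL2 (missing N K s) a) = specChar N K s F.toFun a := by
  ext1 x
  have hC : stackC (missing N K s) F.toFun a =
      fun k => coeffC (missing N K s) F.toFun a k.1 k.2 := by
    ext k
    simp [coeffC]
  have h1 : trigPoly (unstack (missing N K s) (stackC (missing N K s) F.toFun a)) x =
      ∑ j ∈ missing N K s, cexpI j x • coeffC (missing N K s) F.toFun a j := by
    rw [hC, trigPoly_unstack]
  have h2 : trigPoly (unstack (missing N K s) (stackA T (missing N K s) a)) x =
      ∑ j ∈ missing N K s, cexpI j x • vecCoeff T a j :=
    trigPoly_unstack _ _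
  rw [charL2, Density.fn_sub, Pi.sub_apply, hm.fn_dual, Density.fn_trig, Density.fn_trig, h2]
  beta_reduce
  rw [h1, specChar, blockSum_eq_sum_missing, blockSum_eq_sum_missing]

/-- This is the equation $B_s c_s = a_s$ read row by row. -/
theorem inner_dual_charL2 (k : S × Fin T) :
    inner ℂ (hm.dual (hm.inv.trig (Finsupp.single (k.1 : ℤ) (Pi.single k.2 1))))
      (hm.charL2 S a) = 0 := by
  rw [charL2, inner_sub_right, hm.inner_dual_single_trig, hm.inner_dual_dual, ← hm.matB_mulVec,
    hm.matB_mulVec_stackC, unstack_apply_of_mem, sub_self]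

/-- The error is a combination of dual vectors with index in $S$, so biorthogonality applies. -/
theorem inner_trig_sub_charL2 {p : ℤ →₀ (Fin T → ℂ)} (hp : Disjoint p.support S) :
    inner ℂ (F.trig p) (F.trig (unstack S (stackA T S a)) - hm.charL2 S a) = 0 := by
  rw [charL2, sub_sub_cancel, ← inner_conj_symm, hm.inner_dual_trig, Finsupp.sum,
    Finset.sum_eq_zero, map_zero]
  intro j hj
  rw [unstack_apply_of_notMem _ (Finset.disjoint_left.1 hp hj), star_zero, dotProduct_zero]

/-- The error has squared norm $c_s^*B_sc_s = c_s^*a_s$, the conjugate of $\langle c_s,a_s\rangle$.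
Being a squared norm, it is real. -/
theorem norm_sub_charL2_sq :
    ((‖F.trig (unstack S (stackA T S a)) - hm.charL2 S a‖ ^ 2 : ℝ) : ℂ) =
      errValue S F.toFun a := by
  have h : inner ℂ (hm.dual (hm.inv.trig (unstack S (stackC S F.toFun a))))
      (hm.dual (hm.inv.trig (unstack S (stackC S F.toFun a)))) =
      (starRingEnd ℂ) (errValue S F.toFun a) := by
    rw [hm.inner_dual_dual, hm.inner_trig_unstack, hm.matB_mulVec_stackC]
    simp [errValue, dotProduct]
  rw [← inner_conj_symm, (starRingEnd ℂ).injective.eq_iff] at h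
  rw [← h, charL2, sub_sub_cancel]
  simp

/-- The spectral characteristic is a limit of trigonometric polynomials without frequencies in
`S`. -/
theorem exists_tendsto_charL2 : ∃ p : ℕ → ℤ →₀ (Fin T → ℂ),
    (∀ n, Disjoint (p n).support S) ∧
      Tendsto (fun n => F.trig (p n)) atTop (𝓝 (hm.charL2 S a)) := by
  obtain ⟨y, hy, hlim⟩ := mem_closure_iff_seq_limit.1
    (Density.denseRange_trig (F := F) (hm.charL2 S a))
  choose p hp using hy
  have hp' : Tendsto (fun n => F.trig (p n)) atTop (𝓝 (hm.charL2 S a)) := by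
    simpa only [hp] using hlim
  -- Drop the frequencies in $S$. Their coefficients are inner products with dual vectors orthogonal
  -- to the limit, so the dropped part tends to zero.
  refine ⟨fun n => p n - unstack S fun k => p n k.1 k.2, fun n => ?_, ?_⟩
  · rw [Finset.disjoint_right]
    intro j hj
    rw [Finsupp.notMem_support_iff, Finsupp.sub_apply, sub_eq_zero]
    ext ν
    exact (unstack_apply_of_mem (fun k => p n k.1 k.2) (⟨j, hj⟩, ν)).symm
  · have hcoef : ∀ k : S × Fin T, Tendsto (fun n => p n k.1 k.2) atTop (𝓝 0) := by
      intro k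
      rw [← hm.inner_dual_charL2 a k]
      refine Tendsto.congr (fun n => hm.inner_dual_single_trig _ _ _) ?_
      exact tendsto_const_nhds.inner hp'
    have hun : Tendsto (fun n => F.trig (unstack S fun k => p n k.1 k.2)) atTop (𝓝 0) := by
      simp only [unstack_eq_sum, map_sum, map_smul]
      have := tendsto_finsetSum (Finset.univ : Finset (S × Fin T)) fun k _ =>
        (hcoef k).smul_const (F.trig (Finsupp.single (k.1 : ℤ) (Pi.single k.2 1)))
      simpa using this
    simpa using hp'.sub hun

theorem memL2Minus_charL2 : MemL2Minus S F.toFun (Density.fn (hm.charL2 S a)) := by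
  refine ⟨Density.memL2_fn _, fun ε hε => ?_⟩
  obtain ⟨p, hp, hlim⟩ := hm.exists_tendsto_charL2 (S := S) a
  rw [← Density.tendsto_iff_sqNorm] at hlim
  obtain ⟨n, hn⟩ := (hlim.eventually (gt_mem_nhds hε)).exists
  exact ⟨p n, hp n, hn⟩

end MinimalityCondition

end Interpolation

/-! ### Optimal estimates -/

section Estimates

variable {Ω : Type u} [MeasurableSpace Ω] {P : Measure Ω} {ι : Type*}

/-- The orthogonal projection is the unique optimal linear estimate. -/
theorem isOptimalEstimate_iff (obs : ι → Lp ℂ 2 P) (I : Set ι) {X Y : Lp ℂ 2 P}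
    (hY : Y ∈ (Submodule.span ℂ (obs '' I)).topologicalClosure)
    (horth : ∀ i ∈ I, inner ℂ (obs i) (X - Y) = 0) (Y' : Lp ℂ 2 P) :
    IsOptimalEstimate P obs I X Y' ↔ Y' = Y := by
  set M := (Submodule.span ℂ (obs '' I)).topologicalClosure
  have hM : ∀ W ∈ M, inner ℂ W (X - Y) = 0 := by
    intro W hW
    have hspan : ∀ W ∈ Submodule.span ℂ (obs '' I), inner ℂ W (X - Y) = 0 := by
      intro W hW
      induction hW using Submodule.span_induction with
      | mem W hW => obtain ⟨i, hi, rfl⟩ := hW; exact horth i hi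
      | zero => exact inner_zero_left _
      | add W W' _ _ h h' => rw [inner_add_left, h, h', add_zero]
      | smul r W _ h => rw [inner_smul_left, h, mul_zero]
    exact closure_minimal (t := {W | inner ℂ W (X - Y) = 0}) hspan
      (isClosed_eq (continuous_id.inner continuous_const) continuous_const) hW
  -- Pythagoras yields optimality and uniqueness together.
  have hpyth : ∀ W ∈ M, ‖X - W‖ ^ 2 = ‖X - Y‖ ^ 2 + ‖Y - W‖ ^ 2 := by
    intro W hW
    have h0 : inner ℂ (X - Y) (Y - W) = 0 := by
      rw [← inner_conj_symm, hM _ (M.sub_mem hY hW), map_zero]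
    have := norm_add_sq_eq_norm_sq_add_norm_sq_of_inner_eq_zero (𝕜 := ℂ) (X - Y) (Y - W) h0
    rw [sub_add_sub_cancel] at this
    nlinarith
  constructor
  · rintro ⟨h1, h2⟩
    have h3 := h2 Y hY
    rw [mse_eq_norm, mse_eq_norm, hpyth Y' h1] at h3
    have h4 : ‖Y - Y'‖ = 0 := by nlinarith [norm_nonneg (Y - Y'), sq_nonneg ‖Y - Y'‖]
    exact (sub_eq_zero.1 (norm_eq_zero.1 h4)).symm
  · rintro rfl
    refine ⟨hY, fun W hW => ?_⟩
    rw [mse_eq_norm, mse_eq_norm, hpyth W hW]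
    nlinarith [sq_nonneg ‖Y' - W‖]

variable {T : ℕ} {ξ : ℤ → Fin T → Lp ℂ 2 P} {f : ℝ → Matrix (Fin T) (Fin T) ℂ}
  {ζ : ℤ → Lp ℂ 2 P}

theorem functional_eq_combination (hξ : IsGenerating P T ζ ξ) (N K : ℕ → ℕ) (s : ℕ)
    (a : ℤ → ℂ) : functional N K s a ζ =
      combination ξ (unstack (missing N K s) (stackA T (missing N K s) a)) := by
  have h : stackA T (missing N K s) a = fun k => vecCoeff T a k.1 k.2 := rfl
  rw [functional, blockSum_eq_sum_missing, h, unstack_eq_sum_single, map_sum]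
  refine Finset.sum_congr rfl fun j _ => ?_
  rw [combination_single, hξ.repr, Finset.smul_sum]
  simp only [vecCoeff, smul_smul]

theorem combination_mem_span (p : ℤ →₀ (Fin T → ℂ)) {S : Finset ℤ} (hp : Disjoint p.support S) :
    combination ξ p ∈ Submodule.span ℂ ((fun i : ℤ × Fin T => ξ i.1 i.2) '' {i | i.1 ∉ S}) := by
  rw [combination_apply]
  refine Submodule.sum_mem _ fun j hj => Submodule.sum_mem _ fun ν _ =>
    Submodule.smul_mem _ _ (Submodule.subset_span ⟨(j, ν), Finset.disjoint_left.1 hp hj, rfl⟩)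

variable (hf : IsSpectralDensity P ξ f) (hm : MinimalityCondition hf.density.toFun)
  (S : Finset ℤ) (a : ℤ → ℂ)

theorem isometry_charL2_mem : hf.isometry (hm.charL2 S a) ∈ (Submodule.span ℂ
    ((fun i : ℤ × Fin T => ξ i.1 i.2) '' {i | i.1 ∉ S})).topologicalClosure := by
  obtain ⟨p, hp, hlim⟩ := hm.exists_tendsto_charL2 (S := S) a
  refine mem_closure_of_tendsto ((hf.isometry.continuous.tendsto _).comp hlim)
    (Eventually.of_forall fun n => ?_)
  rw [Function.comp, hf.isometry_trig]
  exact combination_mem_span _ (hp n)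

theorem inner_sub_isometry_charL2 {j : ℤ} (hj : j ∉ S) (ν : Fin T) :
    inner ℂ (ξ j ν) (combination ξ (unstack S (stackA T S a)) - hf.isometry (hm.charL2 S a)) =
      0 := by
  rw [← combination_single_single ξ j ν, ← hf.isometry_trig, ← hf.isometry_trig, ← map_sub,
    LinearIsometry.inner_map_map]
  refine hm.inner_trig_sub_charL2 a (Finset.disjoint_left.2 fun i hi => ?_)
  rw [Finset.mem_singleton.1 (Finsupp.support_single_subset hi)]
  exact hj

theorem mse_isometry_charL2 : (mse P (combination ξ (unstack S (stackA T S a)))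
    (hf.isometry (hm.charL2 S a)) : ℂ) = errValue S f a := by
  rw [mse_eq_norm, ← hf.isometry_trig, ← map_sub, LinearIsometry.norm_map,
    hm.norm_sub_charL2_sq, hf.density_toFun]

end Estimates

/-! ### Roots of unity -/

section Roots

variable {T : ℕ}

theorem rootExp_add (x y : ℤ) : rootExp T (x + y) = rootExp T x * rootExp T y := by
  rw [rootExp, rootExp, rootExp, ← Complex.exp_add]
  congr 1
  push_cast
  ring

@[simp] theorem rootExp_zero : rootExp T 0 = 1 := by simp [rootExp]

theorem conj_rootExp (x : ℤ) : (starRingEnd ℂ) (rootExp T x) = rootExp T (-x) := by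
  rw [rootExp, rootExp, ← Complex.exp_conj]
  congr 1
  simp [Complex.conj_ofNat]

theorem rootExp_eq_zpow (x : ℤ) : rootExp T x = rootExp T 1 ^ x := by
  rw [rootExp, rootExp, ← Complex.exp_int_mul]
  congr 1
  push_cast
  ring

theorem rootExp_eq_one_iff (hT : 0 < T) (x : ℤ) : rootExp T x = 1 ↔ (T : ℤ) ∣ x := by
  rw [rootExp_eq_zpow, ← (Complex.isPrimitiveRoot_exp T hT.ne').zpow_eq_one_iff_dvd]
  simp [rootExp]

theorem rootExp_mul_natCast (x : ℤ) (n : ℕ) : rootExp T (x * n) = rootExp T x ^ n := by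
  rw [rootExp_eq_zpow, rootExp_eq_zpow x, _root_.zpow_mul, zpow_natCast]

/-- Orthogonality of characters. The labels start at 1, so a factor $e^{2\pi i n/T}$ splits off the
geometric sum; it equals 1 when $T \mid n$, and otherwise the sum vanishes. -/
theorem sum_rootExp_label (hT : 0 < T) (n : ℤ) :
    ∑ ν : Fin T, rootExp T (n * label ν) = if (T : ℤ) ∣ n then (T : ℂ) else 0 := by
  have h : ∀ ν : Fin T, rootExp T (n * label ν) = rootExp T n ^ (ν : ℕ) * rootExp T n := by
    intro ν
    rw [label, mul_add, mul_one, rootExp_add]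
    congr 1
    exact rootExp_mul_natCast n ν
  simp only [h]
  rw [← Finset.sum_mul, Fin.sum_univ_eq_sum_range fun i => rootExp T n ^ i]
  split_ifs with hd
  · rw [(rootExp_eq_one_iff hT n).2 hd]
    simp
  · have h1 : rootExp T n ≠ 1 := fun h => hd ((rootExp_eq_one_iff hT n).1 h)
    have h2 : rootExp T n ^ T = 1 := by
      rw [← rootExp_mul_natCast, rootExp_eq_one_iff hT]
      exact dvd_mul_left _ _
    rw [geom_sum_eq h1, h2, sub_self, zero_div, zero_mul]

theorem sum_rootExp_range (hT : 0 < T) (n : ℤ) :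
    ∑ k : Fin T, rootExp T (n * (k : ℕ)) = if (T : ℤ) ∣ n then (T : ℂ) else 0 := by
  rw [← sum_rootExp_label hT n]
  have h : ∀ ν : Fin T, rootExp T (n * label ν) = rootExp T (n * (ν : ℕ)) * rootExp T n := by
    intro ν
    rw [label, mul_add, mul_one, rootExp_add]
  simp only [h]
  rw [← Finset.sum_mul]
  by_cases hd : (T : ℤ) ∣ n
  · rw [(rootExp_eq_one_iff hT n).2 hd, mul_one]
  · have h0 := sum_rootExp_label hT n
    simp only [h] at h0
    rw [← Finset.sum_mul, if_neg hd] at h0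
    have h1 : rootExp T n ≠ 0 := Complex.exp_ne_zero _
    rw [(mul_eq_zero.1 h0).resolve_right h1, zero_mul]

/-- The sum of a periodic sequence over a period does not depend on the period. -/
theorem sum_range_add_of_periodic {g : ℤ → ℂ} (hg : ∀ n, g (n + T) = g n) (n : ℤ) :
    ∑ k ∈ Finset.range T, g (n + k) = ∑ k ∈ Finset.range T, g k := by
  have hstep : ∀ n : ℤ, ∑ k ∈ Finset.range T, g (n + 1 + k) = ∑ k ∈ Finset.range T, g (n + k) := by
    intro n
    have h1 := Finset.sum_range_succ (fun k : ℕ => g (n + k)) T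
    have h2 := Finset.sum_range_succ' (fun k : ℕ => g (n + k)) T
    rw [h1, hg] at h2
    simp only [Nat.cast_zero, add_zero, Nat.cast_add, Nat.cast_one] at h2
    rw [add_right_cancel h2]
    exact Finset.sum_congr rfl fun k _ => by ring_nf
  induction n using Int.induction_on with
  | zero => simp
  | succ i ih => rw [hstep, ih]
  | pred i ih => rw [← ih, ← hstep, sub_add_cancel]

end Roots

/-! ### Enlargements of the probability space -/

section Enlargement

variable {Ω : Type u} [MeasurableSpace Ω] {P : Measure Ω} {Ω' : Type u} [MeasurableSpace Ω']
  {P' : Measure Ω'} {pr : Ω' → Ω} (hpr : MeasurePreserving pr P' P)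

theorem inner_compMeasurePreserving (X Y : Lp ℂ 2 P) :
    inner ℂ (Lp.compMeasurePreserving pr hpr X) (Lp.compMeasurePreserving pr hpr Y) =
      inner ℂ X Y :=
  (Lp.compMeasurePreservingₗᵢ ℂ pr hpr).inner_map_map X Y

theorem corr_compMeasurePreserving (X Y : Lp ℂ 2 P) :
    corr P' (Lp.compMeasurePreserving pr hpr X) (Lp.compMeasurePreserving pr hpr Y) =
      corr P X Y := by
  rw [corr_eq_inner, corr_eq_inner, inner_compMeasurePreserving]

theorem mse_compMeasurePreserving (X Y : Lp ℂ 2 P) :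
    mse P' (Lp.compMeasurePreserving pr hpr X) (Lp.compMeasurePreserving pr hpr Y) =
      mse P X Y := by
  rw [mse_eq_norm, mse_eq_norm, ← map_sub, Lp.norm_compMeasurePreserving]

theorem gladyshevCoeff_compMeasurePreserving (T : ℕ) (ζ : ℤ → Lp ℂ 2 P) (k τ : ℤ) :
    gladyshevCoeff P' T (fun n => Lp.compMeasurePreserving pr hpr (ζ n)) k τ =
      gladyshevCoeff P T ζ k τ := by
  simp only [gladyshevCoeff, corr_compMeasurePreserving]

theorem functional_compMeasurePreserving (N K : ℕ → ℕ) (s : ℕ) (a : ℤ → ℂ) (ζ : ℤ → Lp ℂ 2 P) :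
    functional N K s a (fun n => Lp.compMeasurePreserving pr hpr (ζ n)) =
      Lp.compMeasurePreserving pr hpr (functional N K s a ζ) := by
  have h : ∀ X : Lp ℂ 2 P, Lp.compMeasurePreserving pr hpr X = Lp.compMeasurePreservingₗᵢ ℂ pr hpr X :=
    fun _ => rfl
  simp only [functional, blockSum, h, map_sum, map_smul]

theorem integral_compMeasurePreserving (X : Lp ℂ 2 P) :
    ∫ w, Lp.compMeasurePreserving pr hpr X w ∂P' = ∫ w, X w ∂P := by
  have h := integral_map hpr.aemeasurable
    (Lp.stronglyMeasurable X).aestronglyMeasurable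
  rw [hpr.map_eq] at h
  exact (integral_congr_ae (Lp.coeFn_compMeasurePreserving X hpr)).trans h.symm

end Enlargement

/-! ### Gladyshev's sequence on a product of independent copies -/

section Product

variable {Ω : Type u} [MeasurableSpace Ω] (P : Measure Ω) [IsProbabilityMeasure P] {T : ℕ}

/-- The `k`-th independent copy of a random variable. -/
def copy (k : Fin T) : Lp ℂ 2 P →ₗᵢ[ℂ] Lp ℂ 2 (Measure.pi fun _ : Fin T => P) :=
  Lp.compMeasurePreservingₗᵢ ℂ (Function.eval k) (measurePreserving_eval (fun _ => P) k)

theorem copy_apply (k : Fin T) (X : Lp ℂ 2 P) : copy P k X =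
    Lp.compMeasurePreserving (Function.eval k) (measurePreserving_eval (fun _ => P) k) X := rfl

/-- Distinct coordinates are independent, so the expectation factors; one zero mean suffices. -/
theorem corr_copy_of_ne {k l : Fin T} (hkl : k ≠ l) (X Y : Lp ℂ 2 P) (hX : ∫ w, X w ∂P = 0) :
    corr (Measure.pi fun _ : Fin T => P) (copy P k X) (copy P l Y) = 0 := by
  have hmk := measurePreserving_eval (fun _ : Fin T => P) k
  have hml := measurePreserving_eval (fun _ : Fin T => P) l
  have hind := (ProbabilityTheory.iIndepFun_pi (μ := fun _ : Fin T => P) (X := fun _ w => w)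
    fun _ => aemeasurable_id).indepFun hkl
  have hXm := (Lp.stronglyMeasurable X).measurable
  have hYm := Complex.continuous_conj.measurable.comp (Lp.stronglyMeasurable Y).measurable
  have hXY := hind.comp hXm hYm
  have hmul := hXY.integral_fun_mul_eq_mul_integral
    (hXm.comp hmk.measurable).aestronglyMeasurable (hYm.comp hml.measurable).aestronglyMeasurable
  have hX0 : ∫ w, X (w k) ∂(Measure.pi fun _ : Fin T => P) = 0 := by
    rw [← hX, ← integral_compMeasurePreserving hmk X]
    exact (integral_congr_ae (Lp.coeFn_compMeasurePreserving X hmk)).symm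
  rw [corr]
  refine Eq.trans (integral_congr_ae ?_) (hmul.trans ?_)
  · filter_upwards [Lp.coeFn_compMeasurePreserving X hmk, Lp.coeFn_compMeasurePreserving Y hml]
      with w h1 h2
    rw [copy_apply, copy_apply, h1, h2]
    rfl
  · exact (congrArg (· * _) hX0).trans (zero_mul _)

/-- Gladyshev's generating sequence on the product of `T` copies of the probability space. -/
def gladyshevSeq (T : ℕ) (ζ : ℤ → Lp ℂ 2 P) (n : ℤ) (ν : Fin T) :
    Lp ℂ 2 (Measure.pi fun _ : Fin T => P) :=
  (T : ℂ)⁻¹ • ∑ k : Fin T, rootExp T (-(n + (k : ℕ)) * label ν) • copy P k (ζ (n + (k : ℕ)))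

variable {P} {ζ : ℤ → Lp ℂ 2 P}

/-- Only equal copies contribute, which leaves a sum of $R(m+\tau,m)e^{-2\pi i(\nu-\mu)m/T}$ over
the period starting at $n$. The summand is $T$-periodic in $m$, so the starting point is immaterial,
whence stationarity. -/
theorem corr_gladyshevSeq (hζ : IsPC P T ζ) (n τ : ℤ) (ν μ : Fin T) :
    corr (Measure.pi fun _ : Fin T => P) (gladyshevSeq P T ζ (n + τ) ν) (gladyshevSeq P T ζ n μ) =
      (T : ℂ)⁻¹ * gladyshevCoeff P T ζ (label ν - label μ) τ * rootExp T (-(label ν * τ)) := by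
  have hcopy : ∀ (k l : Fin T) (X Y : Lp ℂ 2 P), ∫ w, X w ∂P = 0 →
      inner ℂ (copy P l Y) (copy P k X) = if k = l then corr P X Y else 0 := by
    intro k l X Y hX
    split_ifs with h
    · rw [h, LinearIsometry.inner_map_map, corr_eq_inner]
    · rw [← corr_eq_inner, corr_copy_of_ne P h X Y hX]
  have hsum := sum_range_add_of_periodic (T := T)
    (g := fun m => corr P (ζ (m + τ)) (ζ m) * rootExp T (-((label ν - label μ) * m))) (fun m => by
      rw [show m + T + τ = m + τ + T by ring, hζ.periodic,
        show -((label ν - label μ) * (m + T)) =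
          -((label ν - label μ) * m) + -((label ν - label μ)) * T by ring, rootExp_add,
        (rootExp_eq_one_iff hζ.pos _).2 (dvd_mul_left _ _), mul_one]) n
  rw [gladyshevCoeff, ← hsum, corr_eq_inner, gladyshevSeq, gladyshevSeq, inner_smul_left,
    inner_smul_right, ← Fin.sum_univ_eq_sum_range fun k : ℕ =>
      corr P (ζ (n + k + τ)) (ζ (n + k)) * rootExp T (-((label ν - label μ) * (n + k)))]
  simp only [sum_inner, inner_sum, inner_smul_left, inner_smul_right, hcopy _ _ _ _ (hζ.mean _),
    mul_ite, mul_zero, Finset.sum_ite_eq, Finset.mem_univ, if_true,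
    conj_rootExp, map_inv₀, Complex.conj_natCast]
  rw [mul_assoc, mul_assoc, Finset.sum_mul]
  congr 2
  refine Finset.sum_congr rfl fun k _ => ?_
  rw [show n + τ + (k : ℕ) = n + (k : ℕ) + τ by ring]
  have : rootExp T (-(-(n + (k : ℕ)) * label μ)) * rootExp T (-(n + (k : ℕ) + τ) * label ν) =
      rootExp T (-((label ν - label μ) * (n + (k : ℕ)))) * rootExp T (-(label ν * τ)) := by
    rw [← rootExp_add, ← rootExp_add]
    congr 1
    ring
  linear_combination corr P (ζ (n + (k : ℕ) + τ)) (ζ (n + (k : ℕ))) * this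

/-- Copy $k$ receives the coefficient $T^{-1}\sum_\nu e^{-2\pi i k\nu/T}$, which vanishes for
$0<k<T$. -/
theorem sum_rootExp_smul_gladyshevSeq (hT : 0 < T) (n : ℤ) :
    ∑ ν, rootExp T (n * label ν) • gladyshevSeq P T ζ n ν = copy P ⟨0, hT⟩ (ζ n) := by
  simp only [gladyshevSeq, Finset.smul_sum, smul_smul]
  rw [Finset.sum_comm]
  have h : ∀ k ν : Fin T, rootExp T (n * label ν) * ((T : ℂ)⁻¹ *
      rootExp T (-(n + (k : ℕ)) * label ν)) = (T : ℂ)⁻¹ * rootExp T (-(k : ℕ) * label ν) := by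
    intro k ν
    rw [mul_left_comm, ← rootExp_add]
    congr 2
    ring
  simp only [h, ← Finset.sum_smul, ← Finset.mul_sum, sum_rootExp_label hT]
  rw [Finset.sum_eq_single ⟨0, hT⟩]
  · have : (T : ℂ) ≠ 0 := by exact_mod_cast hT.ne'
    simp [this]
  · intro k _ hk
    have hd : ¬ (T : ℤ) ∣ -(k : ℕ) := by
      rw [dvd_neg, Int.natCast_dvd_natCast]
      intro hd
      exact hk (Fin.ext (Nat.eq_zero_of_dvd_of_lt hd k.2))
    rw [if_neg hd, mul_zero, zero_smul]
  · simp

theorem integral_gladyshevSeq (hζ : IsPC P T ζ) (n : ℤ) (ν : Fin T) :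
    ∫ w, gladyshevSeq P T ζ n ν w ∂(Measure.pi fun _ : Fin T => P) = 0 := by
  -- The mean as an inner product with the constant 1 is visibly linear on $L^2$.
  have h : ∀ X : Lp ℂ 2 (Measure.pi fun _ : Fin T => P), ∫ w, X w ∂(Measure.pi fun _ : Fin T => P) =
      inner ℂ (Lp.const 2 (Measure.pi fun _ : Fin T => P) (1 : ℂ)) X := by
    intro X
    rw [L2.inner_def]
    exact integral_congr_ae <| Eventually.of_forall fun w => by simp
  rw [h, gladyshevSeq, inner_smul_right, inner_sum, Finset.sum_eq_zero, mul_zero]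
  intro k _
  rw [inner_smul_right, ← h, copy_apply, integral_compMeasurePreserving, hζ.mean, mul_zero]

theorem isGladyshevGenerating_gladyshevSeq (hζ : IsPC P T ζ) :
    IsGladyshevGenerating (Measure.pi fun _ : Fin T => P) T
      (fun n => Lp.compMeasurePreserving (Function.eval (⟨0, hζ.pos⟩ : Fin T))
        (measurePreserving_eval (fun _ => P) (⟨0, hζ.pos⟩ : Fin T)) (ζ n)) (gladyshevSeq P T ζ) where
  generating :=
    { stationary :=
        { mean := integral_gladyshevSeq hζ
          stationary := fun n m k ν μ => by
            rw [show n + k = m + k + (n - m) by ring, corr_gladyshevSeq hζ,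
              ← corr_gladyshevSeq hζ m, add_sub_cancel] }
      repr := fun n => (sum_rootExp_smul_gladyshevSeq hζ.pos n).symm }
  cov n τ ν μ := by rw [gladyshevCoeff_compMeasurePreserving, corr_gladyshevSeq hζ]

end Product

/-! ### Estimates from the values of a periodically correlated sequence -/

section Gladyshev

variable {Ω : Type u} [MeasurableSpace Ω] {P : Measure Ω} {T : ℕ} {ζ : ℤ → Lp ℂ 2 P}
  {ξ : ℤ → Fin T → Lp ℂ 2 P}

/-- The combinations `∑_ν e^{2πi(n+k)ν/T} ξ_ν(n)`; for `k = 0` they are the values of the sequence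
generated by `ξ`. -/
def twist (ξ : ℤ → Fin T → Lp ℂ 2 P) (k n : ℤ) : Lp ℂ 2 P :=
  ∑ ν, rootExp T ((n + k) * label ν) • ξ n ν

theorem twist_zero (hξ : IsGenerating P T ζ ξ) (n : ℤ) : twist ξ 0 n = ζ n := by
  rw [hξ.repr, twist, add_zero]

/-- Discrete Fourier inversion in $k$ over a full period. -/
theorem eq_sum_twist (hT : 0 < T) (n : ℤ) (ν : Fin T) : ξ n ν = (T : ℂ)⁻¹ •
    ∑ k : Fin T, rootExp T (-((n + (k : ℕ)) * label ν)) • twist ξ (k : ℕ) n := by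
  simp only [twist, Finset.smul_sum, smul_smul]
  rw [Finset.sum_comm]
  have h : ∀ μ k : Fin T, (T : ℂ)⁻¹ * (rootExp T (-((n + (k : ℕ)) * label ν)) *
      rootExp T ((n + (k : ℕ)) * label μ)) = (T : ℂ)⁻¹ * rootExp T (n * (label μ - label ν)) *
        rootExp T ((label μ - label ν) * (k : ℕ)) := by
    intro μ k
    rw [← rootExp_add, mul_assoc, ← rootExp_add]
    congr 2
    ring
  simp only [h, ← Finset.sum_smul, ← Finset.mul_sum, sum_rootExp_range hT]
  rw [Finset.sum_eq_single ν]
  · have : (T : ℂ) ≠ 0 := by exact_mod_cast hT.ne'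
    simp [this]
  · intro μ _ hμ
    have hd : ¬ (T : ℤ) ∣ label μ - label ν := by
      intro hd
      refine hμ (Fin.ext ?_)
      have h1 := μ.2
      have h2 := ν.2
      simp only [label] at hd
      have h3 := Int.eq_zero_of_abs_lt_dvd hd (by rw [abs_lt]; omega)
      omega
    rw [if_neg hd, mul_zero, zero_smul]
  · simp

/-- For a Gladyshev generating sequence the twisted sequences are orthogonal to the generated
sequence. -/
theorem corr_twist_eq_zero (hT : 0 < T) (hξ : IsGladyshevGenerating P T ζ ξ) {k : ℤ}
    (hk : ¬ (T : ℤ) ∣ k) (n m : ℤ) : corr P (twist ξ k n) (ζ m) = 0 := by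
  have hcov : ∀ ν μ, corr P (ξ n ν) (ξ m μ) = (T : ℂ)⁻¹ *
      gladyshevCoeff P T ζ (label ν - label μ) (n - m) * rootExp T (-(label ν * (n - m))) := by
    intro ν μ
    rw [← hξ.cov m (n - m) ν μ, add_sub_cancel]
  rw [hξ.generating.repr, twist, corr_eq_inner]
  simp only [sum_inner, inner_sum, inner_smul_left, inner_smul_right, ← corr_eq_inner, hcov,
    gladyshevCoeff, conj_rootExp]
  have hterm : ∀ (ν μ : Fin T) (i : ℕ), rootExp T ((n + k) * label ν) * (rootExp T (-(m * label μ)) *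
      ((T : ℂ)⁻¹ * ((T : ℂ)⁻¹ * (corr P (ζ (i + (n - m))) (ζ i) *
        rootExp T (-((label ν - label μ) * i)))) * rootExp T (-(label ν * (n - m))))) =
      ((T : ℂ)⁻¹ * (T : ℂ)⁻¹ * corr P (ζ (i + (n - m))) (ζ i)) *
        (rootExp T ((i - m) * label μ) * rootExp T ((k + m - i) * label ν)) := by
    intro ν μ i
    have h : rootExp T (-(m * label μ)) * rootExp T ((n + k) * label ν) *
        rootExp T (-((label ν - label μ) * i)) * rootExp T (-(label ν * (n - m))) =
        rootExp T ((i - m) * label μ) * rootExp T ((k + m - i) * label ν) := by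
      simp only [← rootExp_add]
      congr 1
      ring
    linear_combination ((T : ℂ)⁻¹ * (T : ℂ)⁻¹ * corr P (ζ (i + (n - m))) (ζ i)) * h
  simp only [Finset.mul_sum, Finset.sum_mul, hterm]
  -- For each $i$ the double sum is a product of two character sums. Both survive only if $T$
  -- divides $i-m$ and $k+m-i$, hence their sum $k$.
  have hzero : ∀ i : ℕ, ∑ ν : Fin T, ∑ μ : Fin T,
      ((T : ℂ)⁻¹ * (T : ℂ)⁻¹ * corr P (ζ (i + (n - m))) (ζ i)) *
        (rootExp T ((i - m) * label μ) * rootExp T ((k + m - i) * label ν)) = 0 := by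
    intro i
    simp only [← Finset.mul_sum, ← Finset.sum_mul, sum_rootExp_label hT]
    by_cases h1 : (T : ℤ) ∣ i - m
    · have h2 : ¬ (T : ℤ) ∣ k + m - i := fun h2 => hk <| by
        have := dvd_add h1 h2
        rwa [show (i : ℤ) - m + (k + m - i) = k by ring] at this
      rw [if_neg h2, mul_zero, mul_zero]
    · rw [if_neg h1, zero_mul, mul_zero]
  refine (Finset.sum_congr rfl fun ν _ => Finset.sum_comm).trans (Finset.sum_comm.trans ?_)
  exact Finset.sum_eq_zero fun i _ => hzero i

variable {Ω' : Type u} [MeasurableSpace Ω'] {P' : Measure Ω'} {pr : Ω' → Ω}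
  (hpr : MeasurePreserving pr P' P) {ξ : ℤ → Fin T → Lp ℂ 2 P'}

/-- For a Gladyshev generating sequence, the projection of a combination of the `ζ(j)` on the
observations `ζ(j)`, `j ∉ S`, is also its projection on the observations `ξ_ν(j)`, `j ∉ S`. -/
theorem exists_projection (hT : 0 < T)
    (hξ : IsGladyshevGenerating P' T (fun n => Lp.compMeasurePreserving pr hpr (ζ n)) ξ)
    (S : Finset ℤ) {X : Lp ℂ 2 P} (hX : X ∈ Submodule.span ℂ (Set.range ζ)) :
    ∃ Y : Lp ℂ 2 P, (∀ Y', IsOptimalEstimate P ζ {j | j ∉ S} X Y' ↔ Y' = Y) ∧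
      Lp.compMeasurePreserving pr hpr Y ∈ (Submodule.span ℂ
        ((fun i : ℤ × Fin T => ξ i.1 i.2) '' {i | i.1 ∉ S})).topologicalClosure ∧
      ∀ j ∉ S, ∀ ν, inner ℂ (ξ j ν)
        (Lp.compMeasurePreserving pr hpr X - Lp.compMeasurePreserving pr hpr Y) = 0 := by
  set V := Lp.compMeasurePreservingₗᵢ ℂ (E := ℂ) (p := 2) pr hpr with hV
  have hVapp : ∀ W, Lp.compMeasurePreserving pr hpr W = V W := fun _ => rfl
  simp only [hVapp] at hξ ⊢
  set K := (Submodule.span ℂ (ζ '' {j | j ∉ S})).topologicalClosure with hK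
  have horth : ∀ j ∈ {j | j ∉ S}, inner ℂ (ζ j) (X - K.starProjection X) = 0 := fun j hj =>
    Submodule.inner_right_of_mem_orthogonal
      (K := K)
      (Submodule.le_topologicalClosure _ (Submodule.subset_span (Set.mem_image_of_mem ζ hj)))
      (Submodule.sub_starProjection_mem_orthogonal (K := K) X)
  have hmem := K.starProjection_apply_mem X
  refine ⟨K.starProjection X, isOptimalEstimate_iff ζ _ hmem horth, ?_, fun j hj ν => ?_⟩
  · set M := (Submodule.span ℂ
        ((fun i : ℤ × Fin T => ξ i.1 i.2) '' {i | i.1 ∉ S})).topologicalClosure with hM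
    -- Each $\zeta(j)$ is a combination of the $\xi_\nu(j)$ at the same time $j$, so no missing
    -- index is used.
    have hle : K ≤ M.comap V.toLinearMap := by
      refine Submodule.topologicalClosure_minimal _ (Submodule.span_le.2 ?_)
        ((Submodule.isClosed_topologicalClosure _).preimage V.continuous)
      rintro _ ⟨j, hj, rfl⟩
      change V (ζ j) ∈ M
      rw [hξ.generating.repr]
      exact Submodule.le_topologicalClosure _ (Submodule.sum_mem _ fun ν _ =>
        Submodule.smul_mem _ _ (Submodule.subset_span ⟨(j, ν), hj, rfl⟩))
    exact hle hmem
  · rw [eq_sum_twist (ξ := ξ) hT, inner_smul_left, sum_inner, Finset.sum_eq_zero, mul_zero]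
    intro k _
    rw [inner_smul_left]
    refine mul_eq_zero_of_right _ ?_
    -- The twist with $k=0$ is $\zeta(j)$, orthogonal to the error by projection. The others are
    -- orthogonal to the closed span of all $\zeta(m)$, which contains both the functional and its
    -- projection.
    rcases Nat.eq_zero_or_pos (k : ℕ) with hk | hk
    · rw [hk, Nat.cast_zero, twist_zero hξ.generating, ← map_sub, LinearIsometry.inner_map_map]
      exact horth j hj
    · have hd : ¬ (T : ℤ) ∣ ((k : ℕ) : ℤ) := by
        rw [Int.natCast_dvd_natCast]
        exact Nat.not_dvd_of_pos_of_lt hk k.2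
      set L : Submodule ℂ (Lp ℂ 2 P) :=
        (LinearMap.ker (innerSL ℂ (twist ξ (k : ℕ) j)).toLinearMap).comap V.toLinearMap with hL
      have hLc : IsClosed (L : Set (Lp ℂ 2 P)) :=
        (isClosed_eq (innerSL ℂ (twist ξ (k : ℕ) j)).continuous continuous_const).preimage
          V.continuous
      have hζL : ∀ m, ζ m ∈ L := by
        intro m
        change inner ℂ (twist ξ (k : ℕ) j) (V (ζ m)) = 0
        rw [← inner_conj_symm, ← corr_eq_inner, corr_twist_eq_zero hT hξ hd, map_zero]
      have hXL : X ∈ L := Submodule.span_le.2 (Set.range_subset_iff.2 hζL) hX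
      have hKL : K ≤ L := Submodule.topologicalClosure_minimal _ (Submodule.span_le.2 <| by
        rintro _ ⟨m, -, rfl⟩
        exact hζL m) hLc
      rw [← map_sub]
      exact L.sub_mem hXL (hKL hmem)

theorem functional_mem_span (N K : ℕ → ℕ) (s : ℕ) (a : ℤ → ℂ) :
    functional N K s a ζ ∈ Submodule.span ℂ (Set.range ζ) := by
  rw [functional, blockSum_eq_sum_missing]
  exact Submodule.sum_mem _ fun j _ => Submodule.smul_mem _ _ (Submodule.subset_span ⟨j, rfl⟩)

end Gladyshev

end PCInterp

end

/-! ### The interpolation theorem -/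

theorem mainTheorem4 {Ω : Type u} [MeasurableSpace Ω] (P : Measure Ω) [IsProbabilityMeasure P]
    (T : ℕ) (ζ : ℤ → Lp ℂ 2 P) (hζ : PCInterp.IsPC P T ζ)
    (s : ℕ) (N K : ℕ → ℕ) (hN : N 0 = 0) (hK : K 0 = 0) (a : ℤ → ℂ) :
    -- every T-PC sequence has, on an enlarged probability space, a Gladyshev generating sequence
    (∃ (Ω' : Type u) (_ : MeasurableSpace Ω') (P' : Measure Ω') (_ : IsProbabilityMeasure P')
        (pr : Ω' → Ω) (hpr : MeasurePreserving pr P' P) (ξ : ℤ → Fin T → Lp ℂ 2 P'),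
      PCInterp.IsGladyshevGenerating P' T
        (fun n => Lp.compMeasurePreserving pr hpr (ζ n)) ξ) ∧
    -- for every generating sequence with a spectral density satisfying the minimality condition
    ∀ (Ω' : Type u) [MeasurableSpace Ω'] (P' : Measure Ω') [IsProbabilityMeasure P']
      (pr : Ω' → Ω) (hpr : MeasurePreserving pr P' P) (ξ : ℤ → Fin T → Lp ℂ 2 P')
      (f : ℝ → Matrix (Fin T) (Fin T) ℂ),
      PCInterp.IsGenerating P' T (fun n => Lp.compMeasurePreserving pr hpr (ζ n)) ξ →
      PCInterp.IsSpectralDensity P' ξ f →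
      PCInterp.MinimalityCondition f →
      IsUnit (PCInterp.matB (PCInterp.missing N K s) f).det ∧
      PCInterp.MemL2Minus (PCInterp.missing N K s) f (PCInterp.specChar N K s f a) ∧
      (∃ Z, PCInterp.IsOrthogonalRandomMeasure P' ξ f Z) ∧
      ∀ Z, PCInterp.IsOrthogonalRandomMeasure P' ξ f Z →
        -- the integral is the unique optimal estimate from the values ξ_ν(j), j ∉ S
        (∃ Y : Lp ℂ 2 P',
          (∀ Y', PCInterp.IsStochIntegral P' f Z (PCInterp.specChar N K s f a) Y' ↔ Y' = Y) ∧
          (∀ Y', PCInterp.IsOptimalEstimate P' (fun i : ℤ × Fin T => ξ i.1 i.2)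
              {i | i.1 ∉ PCInterp.missing N K s}
              (PCInterp.functional N K s a fun n => Lp.compMeasurePreserving pr hpr (ζ n)) Y' ↔
            Y' = Y) ∧
          (PCInterp.mse P'
              (PCInterp.functional N K s a fun n => Lp.compMeasurePreserving pr hpr (ζ n)) Y : ℂ) =
            PCInterp.errValue (PCInterp.missing N K s) f a) ∧
        -- if ξ is a Gladyshev generating sequence, it is the unique optimal estimate from the
        -- values ζ(j), j ∉ S
        (PCInterp.IsGladyshevGenerating P' T
            (fun n => Lp.compMeasurePreserving pr hpr (ζ n)) ξ →
          ∃ Y : Lp ℂ 2 P,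
            (∀ Y', PCInterp.IsStochIntegral P' f Z (PCInterp.specChar N K s f a) Y' ↔
              Y' = Lp.compMeasurePreserving pr hpr Y) ∧
            (∀ Y', PCInterp.IsOptimalEstimate P ζ {j | j ∉ PCInterp.missing N K s}
                (PCInterp.functional N K s a ζ) Y' ↔ Y' = Y) ∧
            (PCInterp.mse P (PCInterp.functional N K s a ζ) Y : ℂ) =
              PCInterp.errValue (PCInterp.missing N K s) f a) := by
  refine ⟨⟨_, _, _, inferInstance, _, _, _, PCInterp.isGladyshevGenerating_gladyshevSeq hζ⟩, ?_⟩
  intro Ω' _ P' _ pr hpr ξ f hgen hf hm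
  replace hm : PCInterp.MinimalityCondition hf.density.toFun := hm
  have hfn := hm.fn_charL2 a N K s
  have hmem : PCInterp.MemL2Minus (PCInterp.missing N K s) f (PCInterp.specChar N K s f a) := by
    have := hm.memL2Minus_charL2 (S := PCInterp.missing N K s) a
    rwa [hfn] at this
  refine ⟨hm.isUnit_det_matB, hmem, hf.exists_randomMeasure, fun Z hZ => ?_⟩
  have hint : ∀ Y', PCInterp.IsStochIntegral P' f Z (PCInterp.specChar N K s f a) Y' ↔
      Y' = hf.isometry (hm.charL2 (PCInterp.missing N K s) a) := by
    intro Y'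
    rw [PCInterp.isStochIntegral_iff hf (hZ.eq_isometry hf) hmem.1]
    have : hf.density.elem (PCInterp.specChar N K s f a) hmem.1 =
        hm.charL2 (PCInterp.missing N K s) a := PCInterp.Density.fn_injective hfn.symm
    rw [this]
  have hopt := PCInterp.isOptimalEstimate_iff (fun i : ℤ × Fin T => ξ i.1 i.2)
    {i | i.1 ∉ PCInterp.missing N K s}
    (PCInterp.isometry_charL2_mem hf hm (PCInterp.missing N K s) a)
    (fun i hi => PCInterp.inner_sub_isometry_charL2 hf hm (PCInterp.missing N K s) a hi i.2)
  have hmse := PCInterp.mse_isometry_charL2 hf hm (PCInterp.missing N K s) a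
  have hfun := PCInterp.functional_eq_combination hgen N K s a
  rw [← hfun] at hmse hopt
  refine ⟨⟨_, hint, hopt, hmse⟩, fun hglad => ?_⟩
  obtain ⟨Y, hY, hYmem, hYorth⟩ := PCInterp.exists_projection hpr hζ.pos hglad
    (PCInterp.missing N K s) (PCInterp.functional_mem_span N K s a)
  -- The lift of the projection on the $\zeta(j)$ is also optimal for the $\xi_\nu(j)$, so
  -- uniqueness identifies it with the stochastic integral.
  have hYopt := (PCInterp.isOptimalEstimate_iff (fun i : ℤ × Fin T => ξ i.1 i.2)
    {i | i.1 ∉ PCInterp.missing N K s} hYmem (fun i hi => hYorth i.1 hi i.2) _).2 rfl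
  rw [← PCInterp.functional_compMeasurePreserving, hopt] at hYopt
  refine ⟨Y, fun Y' => by rw [hint, hYopt], hY, ?_⟩
  rw [← hmse, ← hYopt, PCInterp.functional_compMeasurePreserving,
    PCInterp.mse_compMeasurePreserving]
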